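/- Work with currents in $\mathbb{R}^3$ (continuous linear functionals on smooth compactly supported forms), with boundary $\partial$, mass $\operatorname{M}$, and, for $\lambda>0$, the multiscale flat norm $\mathbb{F}_\lambda(H)=\inf_S\{\operatorname{M}(H-\partial S)+\lambda \operatorname{M}(S)\}$, the infimum being over all currents $S$ of one dimension more. Let $T_1,\dots,T_N$ be integral $1$-currents with $\partial T_i=\partial T_j$ for all $i,j$. A median of the $T_i$ is an integral $1$-current $\hat T$ with $\partial\hat T=\partial T_i$ for all $i$ that minimizes $\sum_{i=1}^N\mathbb{F}_\lambda(T-T_i)$ among all integral $1$-currents $T$ with $\partial T=\partial T_i$ for all $i$. A $2$-current $S_i$ is a minimal surface spanned by $\hat T$ and $T_i$ if $\partial S_i=\hat T-T_i$ and $\mathbb{F}_\lambda(\hat T-T_i)=\lambda \operatorname{M}(S_i)$. A $k$-current is smooth at $x$ if near $x$ it is integration, with a constant nonzero integer multiplicity, over an embedded oriented $C^\infty$ $k$-dimensional submanifold with (possibly empty) boundary containing $x$. Tangent cones $T_xS_i$ and $T_x\hat T$ are those of the supports, with vertex placed at $x$. Let $\hat T$ be an integral $1$-current and, for each $i$, let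 $S_i$ be a minimal surface spanned by $\hat T$ and $T_i$. Let $x\in\operatorname{supp}\hat T\setminus\operatorname{supp}\partial\hat T$ be a point that lies on none of the supports $\operatorname{supp}T_i$ and at which $\hat T$ and all $S_i$ are smooth. (1) If $\hat T$ is a median of $T_1,\dots,T_N$, then the tangent cones of the $S_i$ at $x$ form a book: $T_x\hat T$ is a line $L$ through $x$, and there are unit vectors $v_1,\dots,v_N$ orthogonal to $L$ with $\sum_{i=1}^N v_i=0$ such that in a cylinder $C$ centred at $x$ with axis $L$ (in fact in each one, of any radius and height) $T_xS_i\cap C$ is the part in $C$ of the half-plane with edge $L$ that contains $x+v_i$, for every $i$. (2) If the tangent cones of the $S_i$ at $x$ do not form a book in this sense, then a local replacement strictly lowers the sum of flat norms: for every neighbourhood $U$ of $x$ there is an integral $1$-current $\hat T'$ with $\partial\hat T'=\partial\hat T$, $\operatorname{supp}(\hat T'-\hat T)\subseteq U$ and $\sum_{i=1}^N\mathbb{F}_\lambda(\hat T'-T_i)<\sum_{i=1}^N\mathbb{F}_\lambda(\hat T-T_i)$. -/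

import Mathlib

open scoped ENNReal NNReal ContDiff Distributions Topology

noncomputable section

namespace MedianCurrents

/-! ### Forms and currents in three-dimensional space -/

/-- Euclidean three-space. -/
abbrev E3 : Type := EuclideanSpace ℝ (Fin 3)

/-- Smooth compactly supported differential `k`-forms on `ℝ³`, with their usual (LF) topology. -/
abbrev Form (k : ℕ) : Type := 𝓓((⊤ : TopologicalSpace.Opens E3), E3 [⋀^Fin k]→L[ℝ] ℝ)

/-- A `k`-current in `ℝ³`: a continuous linear functional on the space of smooth compactly
supported `k`-forms. -/
abbrev Current (k : ℕ) : Type := Form k →L[ℝ] ℝ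

/-- The exterior derivative, as a continuous linear map on smooth compactly supported forms. -/
def extD (k : ℕ) : Form k →L[ℝ] Form (k + 1) :=
  (TestFunction.postcompCLM (ContinuousAlternatingMap.alternatizeUncurryFinCLM ℝ E3 ℝ)).comp
    (TestFunction.fderivCLM ℝ ⊤ ⊤)

/-- `extD` is the exterior derivative of Mathlib. -/
theorem extD_apply (k : ℕ) (φ : Form k) (x : E3) :
    extD k φ x = extDeriv (fun y => φ y) x := by
  simp [extD, extDeriv, ContinuousAlternatingMap.alternatizeUncurryFinCLM_apply]

/-- The boundary of a current: `∂T (φ) = T (dφ)`. -/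
def boundary {k : ℕ} (T : Current (k + 1)) : Current k := T.comp (extD k)

theorem boundary_apply {k : ℕ} (T : Current (k + 1)) (φ : Form k) :
    boundary T φ = T (extD k φ) := rfl

/-- The support of a current: the complement of the largest open set on which it vanishes. -/
def supp {k : ℕ} (T : Current k) : Set E3 := Distribution.dsupport (fun φ : Form k => T φ)

/-- The mass of a current: the supremum of `T φ` over all forms whose values have norm at most one.
The norm of an alternating form `f` is the least `C` with `|f (v₁, …, v_k)| ≤ C ‖v₁‖ ⋯ ‖v_k‖`,
which is the comass (for `k = 1, 2` in `ℝ³` it is also the Euclidean norm of the covector). -/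
def mass {k : ℕ} (T : Current k) : ℝ≥0∞ :=
  ⨆ (φ : Form k) (_ : ∀ x, ‖φ x‖ ≤ 1), ENNReal.ofReal (T φ)

/-! ### Rectifiable and integral currents -/

/-- The partial derivatives of `f : ℝᵏ → ℝ³` at `u`. -/
def partials {k : ℕ} (f : EuclideanSpace ℝ (Fin k) → E3) (u : EuclideanSpace ℝ (Fin k))
    (a : Fin k) : E3 :=
  fderiv ℝ f u (EuclideanSpace.single a 1)

/-- The `k`-dimensional Jacobian of `f : ℝᵏ → ℝ³` at `u`, that is, the `k`-volume of the
parallelepiped spanned by the partial derivatives. -/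
def jacobian {k : ℕ} (f : EuclideanSpace ℝ (Fin k) → E3) (u : EuclideanSpace ℝ (Fin k)) : ℝ :=
  Real.sqrt (Matrix.det (Matrix.of fun a b : Fin k => inner ℝ (partials f u a) (partials f u b)))

/-- Rectifiable currents (integer multiplicity, finite mass): `T` is a mass-summable countable sum
of push-forwards `f_j♯ ⟦θ_j⟧` of integrable integer-valued multiplicities `θ_j` on `ℝᵏ` under
Lipschitz maps `f_j : ℝᵏ → ℝ³`. The carrying rectifiable set is covered by the ranges of the `f_j`,
and by the area formula `T` is given there by an integer multiplicity and a unit orienting tangent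
`k`-vector. For `k = 0` these are the finite integer combinations of point masses. -/
def IsRectifiable {k : ℕ} (T : Current k) : Prop :=
  ∃ (f : ℕ → EuclideanSpace ℝ (Fin k) → E3) (θ : ℕ → EuclideanSpace ℝ (Fin k) → ℤ),
    (∀ j, ∃ K : ℝ≥0, LipschitzWith K (f j)) ∧
    (∀ j, MeasureTheory.Integrable (fun u => (θ j u : ℝ))) ∧
    Summable (fun j => ∫ u, |(θ j u : ℝ)| * jacobian (f j) u) ∧
    ∀ φ : Form k, HasSum (fun j => ∫ u, (θ j u : ℝ) * φ (f j u) (partials (f j) u)) (T φ)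

/-- Integral currents of positive dimension: both the current and its boundary are rectifiable. -/
def IsIntegral {k : ℕ} (T : Current (k + 1)) : Prop :=
  IsRectifiable T ∧ IsRectifiable (boundary T)

/-! ### The multiscale flat norm, medians and spanning minimal surfaces -/

/-- The multiscale flat norm `F_λ(H) = inf_S M(H - ∂S) + λ M(S)`, the infimum being taken over all
currents `S` of one dimension more. -/
def flatNorm (lam : ℝ≥0) {k : ℕ} (H : Current k) : ℝ≥0∞ :=
  ⨅ S : Current (k + 1), mass (H - boundary S) + (lam : ℝ≥0∞) * mass S

/-- The median functional `∑ᵢ F_λ(T' - Tᵢ)`. -/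
def medianCost (lam : ℝ≥0) {N : ℕ} (T : Fin N → Current 1) (T' : Current 1) : ℝ≥0∞ :=
  ∑ i, flatNorm lam (T' - T i)

/-- `M` is a median of `T₁, …, T_N`: an integral current with the same boundary as every `Tᵢ`
that minimizes `∑ᵢ F_λ(· - Tᵢ)` among all such currents. -/
structure IsMedian (lam : ℝ≥0) {N : ℕ} (T : Fin N → Current 1) (M : Current 1) : Prop where
  integral : IsIntegral M
  boundary_eq : ∀ i, boundary M = boundary (T i)
  minimal : ∀ T' : Current 1, IsIntegral T' → (∀ i, boundary T' = boundary (T i)) →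
    medianCost lam T M ≤ medianCost lam T T'

/-- `S` is a minimal surface spanned by `M` and `T`: it fills `M - T` exactly and realizes the
multiscale flat norm of `M - T`. -/
structure IsSpanningMinimalSurface (lam : ℝ≥0) (M T : Current 1) (S : Current 2) : Prop where
  boundary_eq : boundary S = M - T
  flatNorm_eq : flatNorm lam (M - T) = (lam : ℝ≥0∞) * mass S

/-! ### Smooth currents -/

/-- The inclusion of `ℝᵏ` in `ℝ³` as the plane of the first `k` coordinates (for `k ≤ 3`). -/
def coordIncl (k : ℕ) (u : EuclideanSpace ℝ (Fin k)) : E3 :=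
  WithLp.toLp 2 fun j : Fin 3 => if h : j.1 < k then u ⟨j.1, h⟩ else 0

/-- `T` is smooth at `x`: in a neighbourhood of `x` it is integration, with a nonzero constant
integer multiplicity `m`, over an embedded oriented `C^∞` submanifold with (possibly empty) boundary
which contains `x`. Here `Φ` is a smooth chart of `ℝ³` around `x` which flattens that submanifold to
the half-plane `{u ∈ ℝᵏ | 0 ≤ u₀}`; `x` is a boundary point of it when the first coordinate
of `Φ x` is zero and an interior point otherwise. -/
def IsSmoothAt {k : ℕ} (T : Current k) (x : E3) : Prop :=
  ∃ (Φ : OpenPartialHomeomorph E3 E3) (m : ℤ),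
    x ∈ Φ.source ∧
    ContDiffOn ℝ ∞ Φ Φ.source ∧
    ContDiffOn ℝ ∞ Φ.symm Φ.target ∧
    (∃ u : EuclideanSpace ℝ (Fin k), Φ x = coordIncl k u ∧ 0 ≤ coordIncl k u 0) ∧
    m ≠ 0 ∧
    ∀ φ : Form k, tsupport φ ⊆ Φ.source →
      T φ = (m : ℝ) * ∫ u in {u : EuclideanSpace ℝ (Fin k) |
          coordIncl k u ∈ Φ.target ∧ 0 ≤ coordIncl k u 0},
        φ (Φ.symm (coordIncl k u))
          (fun a => fderiv ℝ Φ.symm (coordIncl k u) (coordIncl k (EuclideanSpace.single a 1)))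

/-! ### Tangent cones and books -/

/-- The tangent cone of a set `A` at `x`, with its vertex placed at `x`: the points `x + w` where
`w` is a limit of `c_n (y_n - x)` with `c_n ≥ 0`, `y_n ∈ A` and `y_n → x`. -/
def tangentConeOf (A : Set E3) (x : E3) : Set E3 := {y | y - x ∈ posTangentConeAt A x}

/-- The line through `x` with direction `e`. -/
def line (x e : E3) : Set E3 := {y | ∃ s : ℝ, y = x + s • e}

/-- The half-plane with edge `line x e` that contains `x + v`. -/
def halfPlane (x e v : E3) : Set E3 := {y | ∃ s t : ℝ, 0 ≤ t ∧ y = x + s • e + t • v}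

/-- The closed solid circular cylinder with centre `x`, axis `line x e` (`e` a unit vector),
radius `r` and height `h`. -/
def cylinder (x e : E3) (r h : ℝ) : Set E3 :=
  {y | |inner ℝ e (y - x)| ≤ h / 2 ∧ ‖(y - x) - inner ℝ e (y - x) • e‖ ≤ r}

/-- The sets `P₁, …, P_N` are the pages of a book in the cylinder with centre `x`, axis direction
`e`, radius `r` and height `h`: they are the parts in the cylinder of half-planes whose edge is the
axis and whose unit directions orthogonal to the axis sum to zero. -/
def IsBook {N : ℕ} (P : Fin N → Set E3) (x e : E3) (r h : ℝ) : Prop :=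
  ∃ v : Fin N → E3, (∀ i, ‖v i‖ = 1 ∧ inner ℝ e (v i) = 0) ∧ ∑ i, v i = 0 ∧
    ∀ i, P i = cylinder x e r h ∩ halfPlane x e (v i)

/-- At `x` the tangent cone of (the support of) `M` is a line, and in every cylinder around `x` with
this line as its axis the tangent cones of (the supports of) the `Sᵢ` form a book. -/
def HasBookTangentConesAt (M : Current 1) {N : ℕ} (S : Fin N → Current 2) (x : E3) : Prop :=
  ∃ e : E3, ‖e‖ = 1 ∧ tangentConeOf (supp M) x = line x e ∧
    ∀ r h : ℝ, 0 < r → 0 < h →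
      IsBook (fun i => cylinder x e r h ∩ tangentConeOf (supp (S i)) x) x e r h

end MedianCurrents

end

/-! Statement (1) is the contrapositive of (2), so everything rests on the local replacement. Near
`x` no `T i` is present, hence `boundary (S i)` agrees with `M` there. Testing this on forms
concentrated at scale `ε` and letting `ε → 0` gives Stokes' theorem in the tangent planes
(`boundary_alignment`): `x` is an edge point of every `S i`, the edge is tangent to `M`, and the
multiplicity is that of `M` up to sign. So each tangent cone is a half-plane bounded by the tangent
line of `M`, with a unit conormal `v i`, and a book can fail only if `w = ∑ v i ≠ 0`.

In that case `M` and all `S i` are pushed forward by `y ↦ y + ε τ ψ((y - x)/ε) w`. This affects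
neither `T i` nor `boundary M`, so the pushed `S i` fills `M' - T i`. The cost of `M'` is therefore
at most `lam` times the total mass of the pushed surfaces, while the cost of `M` equals `lam` times
the total mass of the `S i`. Moving the edge of a half-plane towards its conormal loses area: the
mass of `S i` grows by at most `|m| ε² (-τ ⟨v i, w⟩ K + C τ² + o(1))`, with `m` the multiplicity of
`M` and `K` the integral of `ψ` along the edge. The weight `|m|` is common to all sheets, so the sum
is at most `|m| ε² (-τ ‖w‖² K + O(τ²) + o(1))`, negative once `τ` and then `ε` are small.

The limit at small scale is `tendsto_blowup`. The comparison of masses is `push_apply_le`, which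
needs only the definition of mass by duality. The first variation in the tangent half-plane is
`exists_movedArea_bound`, and `exists_lower_cost` adds up the sheets. -/

noncomputable section

namespace MedianCurrents

/-! ### Smoothness of pull-backs of alternating forms -/

section AlternatingSmooth

variable {E F G : Type*} [NormedAddCommGroup E] [NormedSpace ℝ E] [NormedAddCommGroup F]
  [NormedSpace ℝ F] [NormedAddCommGroup G] [NormedSpace ℝ G]

/-- The normalized alternatization, a continuous linear retraction of multilinear maps onto
alternating maps. -/
def alternatingRetraction (k : ℕ) :
    ContinuousMultilinearMap ℝ (fun _ : Fin k => E) G →L[ℝ] E [⋀^Fin k]→L[ℝ] G :=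
  LinearMap.mkContinuous
    { toFun := fun f => (Nat.factorial k : ℝ)⁻¹ • ContinuousMultilinearMap.alternatization f
      map_add' := fun f g => by simp
      map_smul' := fun c f => by
        ext v
        simp [ContinuousMultilinearMap.alternatization_apply_apply, Finset.smul_sum,
          smul_comm c] }
    1 (fun f => by
      refine ContinuousAlternatingMap.opNorm_le_bound _ (by positivity) fun v => ?_
      have h : ‖ContinuousMultilinearMap.alternatization f v‖
          ≤ (Nat.factorial k : ℝ) * (‖f‖ * ∏ i, ‖v i‖) := by
        rw [ContinuousMultilinearMap.alternatization_apply_apply]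
        refine (norm_sum_le _ _).trans ?_
        have : ∀ σ ∈ (Finset.univ : Finset (Equiv.Perm (Fin k))),
            ‖Equiv.Perm.sign σ • f (v ∘ σ)‖ ≤ ‖f‖ * ∏ i, ‖v i‖ := by
          intro σ _
          have h1 : ‖Equiv.Perm.sign σ • f (v ∘ σ)‖ = ‖f (v ∘ σ)‖ := by
            rcases Int.units_eq_one_or (Equiv.Perm.sign σ) with h | h <;> simp [h]
          rw [h1]
          refine (f.le_opNorm _).trans_eq ?_
          congr 1
          exact Equiv.prod_comp σ (fun i => ‖v i‖)
        refine (Finset.sum_le_card_nsmul _ _ _ this).trans_eq ?_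
        simp [Fintype.card_perm]
      have hk : (0 : ℝ) < Nat.factorial k := by positivity
      simp only [LinearMap.coe_mk, AddHom.coe_mk, ContinuousAlternatingMap.smul_apply, norm_smul,
        norm_inv, Real.norm_natCast, one_mul]
      rw [inv_mul_le_iff₀ hk]
      exact h)

theorem alternatingRetraction_apply (k : ℕ) (f : E [⋀^Fin k]→L[ℝ] G) :
    alternatingRetraction k f.toContinuousMultilinearMap = f := by
  ext v
  have h := congrArg (fun a : E [⋀^Fin k]→ₗ[ℝ] G => a v)
    (AlternatingMap.coe_alternatization f.toAlternatingMap)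
  simp only [AlternatingMap.smul_apply, Fintype.card_fin] at h
  have h2 : ContinuousMultilinearMap.alternatization f.toContinuousMultilinearMap v
      = Nat.factorial k • f v := by
    rw [← ContinuousAlternatingMap.coe_toAlternatingMap (f := ContinuousMultilinearMap.alternatization _),
      ContinuousMultilinearMap.alternatization_apply_toAlternatingMap]
    exact h
  have hk : (Nat.factorial k : ℝ) ≠ 0 := by positivity
  simp [alternatingRetraction, h2, ← Nat.cast_smul_eq_nsmul ℝ, smul_smul, hk]

/-- On multilinear maps, precomposition is itself continuous multilinear in the linear maps, hence
smooth. The retraction brings the result back to alternating maps. -/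
theorem contDiff_compContinuousLinearMap {k : ℕ} {n : WithTop ℕ∞} {H : Type*}
    [NormedAddCommGroup H] [NormedSpace ℝ H] {f : H → F [⋀^Fin k]→L[ℝ] G} {g : H → E →L[ℝ] F}
    (hf : ContDiff ℝ n f) (hg : ContDiff ℝ n g) :
    ContDiff ℝ n fun x => (f x).compContinuousLinearMap (g x) := by
  have h1 : ContDiff ℝ n fun x =>
      (ContinuousMultilinearMap.compContinuousLinearMapContinuousMultilinear ℝ
        (fun _ : Fin k => E) (fun _ => F) G (fun _ => g x))
      (ContinuousAlternatingMap.toContinuousMultilinearMapCLM ℝ (f x)) :=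
    ((ContinuousMultilinearMap.contDiff _).comp (contDiff_pi.2 fun _ => hg)).clm_apply
      ((ContinuousLinearMap.contDiff _).comp hf)
  have h2 := (alternatingRetraction (E := E) (G := G) k).contDiff.comp h1
  convert h2 using 1
  funext x
  exact (alternatingRetraction_apply k _).symm

end AlternatingSmooth

/-! ### Mass bounds -/

/-- Homogeneity turns the supremum over unit forms into an operator bound. Finiteness matters
because `toReal` sends `⊤` to zero. -/
theorem apply_le_mass_mul {k : ℕ} {T : Current k} (hT : mass T ≠ ⊤) {φ : Form k} {B : ℝ}
    (hB : 0 ≤ B) (h : ∀ x, ‖φ x‖ ≤ B) : T φ ≤ (mass T).toReal * B := by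
  rcases hB.eq_or_lt with rfl | hB
  · have : φ = 0 := by
      ext1 x
      exact norm_le_zero_iff.1 (h x)
    simp [this]
  · have h1 : ENNReal.ofReal (T (B⁻¹ • φ)) ≤ mass T := by
      refine le_iSup₂_of_le (B⁻¹ • φ) (fun x => ?_) le_rfl
      rw [_root_.smul_apply, norm_smul, norm_inv, Real.norm_of_nonneg hB.le, inv_mul_le_iff₀ hB]
      simpa using h x
    have h2 := (ENNReal.ofReal_le_iff_le_toReal hT).1 h1
    rw [map_smul, smul_eq_mul, inv_mul_le_iff₀ hB] at h2
    linarith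

theorem mass_le_ofReal {k : ℕ} {T : Current k} {C : ℝ}
    (h : ∀ φ : Form k, (∀ x, ‖φ x‖ ≤ 1) → T φ ≤ C) : mass T ≤ ENNReal.ofReal C :=
  iSup₂_le fun φ hφ => ENNReal.ofReal_le_ofReal (h φ hφ)

/-- A linear functional on forms which is bounded by the supremum norm is a current. -/
def currentOfBound {k : ℕ} (L : Form k →ₗ[ℝ] ℝ) (C : ℝ)
    (h : ∀ (φ : Form k) (B : ℝ), 0 ≤ B → (∀ x, ‖φ x‖ ≤ B) → L φ ≤ C * B) : Current k where
  toLinearMap := L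
  cont := by
    -- The supremum norm is continuous for the topology of test forms, and the one-sided bound
    -- becomes two-sided on passing to `-φ`.
    have hb : ∀ φ : Form k, ‖L φ‖ ≤ C * ‖TestFunction.toBoundedContinuousFunctionCLM ℝ φ‖ := by
      intro φ
      have hφ : ∀ x, ‖φ x‖ ≤ ‖TestFunction.toBoundedContinuousFunctionCLM ℝ φ‖ := fun x =>
        BoundedContinuousFunction.norm_coe_le_norm
          (TestFunction.toBoundedContinuousFunctionCLM ℝ φ) x
      rw [Real.norm_eq_abs, abs_le]
      constructor
      · have := h (-φ) _ (norm_nonneg _) (fun x => by simpa using hφ x)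
        rw [map_neg] at this
        exact neg_le.1 this
      · exact h φ _ (norm_nonneg _) hφ
    refine continuous_of_continuousAt_zero L.toAddMonoidHom ?_
    change Filter.Tendsto L (𝓝 0) (𝓝 (L 0))
    rw [map_zero]
    refine squeeze_zero_norm hb ?_
    have : Continuous fun φ : Form k =>
        C * ‖TestFunction.toBoundedContinuousFunctionCLM ℝ φ‖ := by fun_prop
    have h0 := this.tendsto 0
    rwa [map_zero, norm_zero, mul_zero] at h0

/-! ### Pull-backs and push-forwards -/

/-- A smooth map of space to itself which is the identity outside of a compact set. -/
structure Deformation where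
  /-- The underlying map. -/
  toFun : E3 → E3
  contDiff : ContDiff ℝ ∞ toFun
  hasCompactSupport : HasCompactSupport fun y => toFun y - y

namespace Deformation

variable (h : Deformation)

theorem exists_lipschitz : ∃ K : ℝ≥0, LipschitzWith K h.toFun ∧ ∀ y, ‖fderiv ℝ h.toFun y‖ ≤ K := by
  have h1 : ContDiff ℝ ∞ fun y => h.toFun y - y := h.contDiff.sub contDiff_id
  have h2 : Continuous (fderiv ℝ fun y => h.toFun y - y) := h1.continuous_fderiv (by simp)
  obtain ⟨C, hC⟩ := h2.bounded_above_of_compact_support (h.hasCompactSupport.fderiv ℝ)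
  have hC0 : 0 ≤ C := (norm_nonneg _).trans (hC 0)
  have hd : Differentiable ℝ h.toFun := h.contDiff.differentiable (by simp)
  have hb : ∀ y, ‖fderiv ℝ h.toFun y‖ ≤ (⟨C + 1, by positivity⟩ : ℝ≥0) := by
    intro y
    have h3 := hC y
    rw [fderiv_fun_sub (hd y) differentiableAt_fun_id, fderiv_fun_id] at h3
    have h4 : fderiv ℝ h.toFun y = (fderiv ℝ h.toFun y - ContinuousLinearMap.id ℝ E3)
        + ContinuousLinearMap.id ℝ E3 := by abel
    rw [h4]
    exact (norm_add_le _ _).trans (add_le_add h3 ContinuousLinearMap.norm_id_le)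
  exact ⟨_, lipschitzWith_of_nnnorm_fderiv_le hd hb, hb⟩

/-- Off the supports of both the form and the displacement, the point is fixed and the form vanishes
at it. -/
theorem pullback_hasCompactSupport {k : ℕ} (φ : Form k) :
    HasCompactSupport fun y => (φ (h.toFun y)).compContinuousLinearMap (fderiv ℝ h.toFun y) := by
  refine HasCompactSupport.intro (φ.hasCompactSupport.isCompact.union
    h.hasCompactSupport.isCompact) fun y hy => ?_
  simp only [Set.mem_union, not_or] at hy
  have h1 : h.toFun y = y := by
    have := image_eq_zero_of_notMem_tsupport hy.2
    simpa [sub_eq_zero] using this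
  rw [h1, image_eq_zero_of_notMem_tsupport hy.1]
  rfl

/-- The pull-back of smooth compactly supported forms. -/
def pullback (k : ℕ) : Form k →ₗ[ℝ] Form k where
  toFun φ :=
    { toFun := fun y => (φ (h.toFun y)).compContinuousLinearMap (fderiv ℝ h.toFun y)
      contDiff' := contDiff_compContinuousLinearMap (φ.contDiff.comp h.contDiff)
        (h.contDiff.fderiv_right (by simp))
      hasCompactSupport' := h.pullback_hasCompactSupport φ
      tsupport_subset' := fun _ _ => trivial }
  map_add' φ ψ := by ext; rfl
  map_smul' c φ := by ext; rfl

theorem pullback_apply {k : ℕ} (φ : Form k) (y : E3) :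
    h.pullback k φ y = (φ (h.toFun y)).compContinuousLinearMap (fderiv ℝ h.toFun y) := rfl

theorem pullback_extD {k : ℕ} (φ : Form k) :
    h.pullback (k + 1) (extD k φ) = extD k (h.pullback k φ) := by
  ext1 y
  rw [extD_apply, pullback_apply, extD_apply]
  refine (extDeriv_pullback (r := ∞) ?_ h.contDiff.contDiffAt ?_).symm
  · exact (φ.contDiff.differentiable (by simp)) _
  · simp [minSmoothness_of_isRCLikeNormedField]
    exact WithTop.coe_le_coe.2 le_top

theorem exists_pullback_bound (k : ℕ) : ∃ C : ℝ, 0 ≤ C ∧ ∀ (φ : Form k) (B : ℝ),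
    (∀ x, ‖φ x‖ ≤ B) → ∀ x, ‖h.pullback k φ x‖ ≤ C * B := by
  obtain ⟨K, -, hK⟩ := h.exists_lipschitz
  refine ⟨(K : ℝ) ^ k, by positivity, fun φ B hB x => ?_⟩
  rw [pullback_apply]
  refine (ContinuousAlternatingMap.norm_compContinuousLinearMap_le _ _).trans ?_
  rw [mul_comm, Fintype.card_fin]
  gcongr
  · exact hK x
  · exact hB _

/-- The push-forward of a current of finite mass. -/
def push {k : ℕ} (T : Current k) (hT : mass T ≠ ⊤) : Current k :=
  -- Finite mass gives continuity through a supremum bound, so the pull-back is only needed as a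
  -- linear map.
  currentOfBound (T.toLinearMap.comp (h.pullback k))
    ((mass T).toReal * (h.exists_pullback_bound k).choose) (fun φ B hB hφ => by
      have := (h.exists_pullback_bound k).choose_spec
      rw [mul_assoc]
      exact apply_le_mass_mul hT (mul_nonneg this.1 hB) (this.2 φ B hφ))

theorem push_apply {k : ℕ} (T : Current k) (hT : mass T ≠ ⊤) (φ : Form k) :
    h.push T hT φ = T (h.pullback k φ) := rfl

/-- The boundary of `T` may have infinite mass, so it is evaluated on the pulled-back form instead
of being pushed forward. -/
theorem boundary_push_apply {k : ℕ} (T : Current (k + 1)) (hT : mass T ≠ ⊤) (φ : Form k) :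
    boundary (h.push T hT) φ = boundary T (h.pullback k φ) := by
  rw [boundary_apply, push_apply, pullback_extD, boundary_apply]

theorem pullback_eq_of_notMem {k : ℕ} (φ : Form k) {y : E3}
    (hy : y ∉ tsupport fun y => h.toFun y - y) : h.pullback k φ y = φ y := by
  have h0 : (fun y => h.toFun y - y) =ᶠ[𝓝 y] 0 := notMem_tsupport_iff_eventuallyEq.1 hy
  have h1 : h.toFun =ᶠ[𝓝 y] id := by
    filter_upwards [h0] with z hz
    simpa [sub_eq_zero] using hz
  rw [pullback_apply, h1.fderiv_eq, h1.eq_of_nhds, fderiv_id]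
  ext v
  rfl

theorem tsupport_pullback_sub {k : ℕ} (φ : Form k) :
    tsupport (h.pullback k φ - φ) ⊆ tsupport fun y => h.toFun y - y := by
  refine closure_minimal (fun y hy => ?_) (isClosed_tsupport _)
  by_contra hc
  exact hy (by rw [_root_.sub_apply, h.pullback_eq_of_notMem φ hc, sub_self])

/-- A form and its pull-back differ only where points move, and there `T` vanishes. This is what
keeps the `T i` and `boundary M` fixed. -/
theorem apply_pullback_eq {k : ℕ} {T : Current k} {s : Set E3}
    (hs : Distribution.IsVanishingOn (fun φ : Form k => T φ) s)
    (hh : tsupport (fun y => h.toFun y - y) ⊆ s) (φ : Form k) : T (h.pullback k φ) = T φ := by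
  have := hs (h.pullback k φ - φ) ((h.tsupport_pullback_sub φ).trans hh)
  simpa [sub_eq_zero] using this

/-- A form that vanishes on `s` equals its pull-back: on `s` both vanish, because `s` is mapped into
itself, and off `s` no point moves. -/
theorem supp_push_sub_subset {k : ℕ} (T : Current k) (hT : mass T ≠ ⊤) {s : Set E3}
    (hs : IsClosed s) (hsup : tsupport (fun y => h.toFun y - y) ⊆ s)
    (hmap : Set.MapsTo h.toFun s s) : supp (h.push T hT - T) ⊆ s := by
  intro y hy
  by_contra hc
  refine (Distribution.notMem_dsupport_iff y).2 ⟨_, ?_, hs.isOpen_compl, hc⟩ hy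
  intro φ hφ
  change h.push T hT φ - T φ = 0
  rw [push_apply, ← map_sub]
  have h0 : ∀ z ∈ s, φ z = 0 := fun z hz =>
    image_eq_zero_of_notMem_tsupport fun hz' => hφ hz' hz
  have : h.pullback k φ - φ = 0 := by
    ext1 z
    rw [_root_.sub_apply]
    by_cases hz : z ∈ s
    · rw [pullback_apply, h0 _ (hmap hz), h0 _ hz, sub_zero]
      rfl
    · rw [h.pullback_eq_of_notMem φ (fun hz' => hz (hsup hz')), sub_self]
      rfl
  rw [this, map_zero]

end Deformation

/-! ### Rectifiable one-dimensional currents -/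

theorem jacobian_one (f : EuclideanSpace ℝ (Fin 1) → E3) (u : EuclideanSpace ℝ (Fin 1)) :
    jacobian f u = ‖partials f u 0‖ := by
  rw [jacobian, Matrix.det_fin_one, Matrix.of_apply, real_inner_self_eq_norm_sq,
    Real.sqrt_sq (norm_nonneg _)]

theorem norm_partials_le {k : ℕ} {f : EuclideanSpace ℝ (Fin k) → E3} {K : ℝ≥0}
    (hf : LipschitzWith K f) (u : EuclideanSpace ℝ (Fin k)) (a : Fin k) :
    ‖partials f u a‖ ≤ K := by
  refine ((fderiv ℝ f u).le_opNorm _).trans ?_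
  simpa using norm_fderiv_le_of_lipschitz ℝ hf

theorem integrable_mul_jacobian_one {f : EuclideanSpace ℝ (Fin 1) → E3} {K : ℝ≥0}
    (hf : LipschitzWith K f) {θ : EuclideanSpace ℝ (Fin 1) → ℤ}
    (hθ : MeasureTheory.Integrable (fun u => (θ u : ℝ))) :
    MeasureTheory.Integrable fun u => |(θ u : ℝ)| * jacobian f u := by
  refine hθ.abs.mul_bdd (c := K) ?_ (Filter.Eventually.of_forall fun u => ?_)
  · have : jacobian f = fun u => ‖fderiv ℝ f u (EuclideanSpace.single 0 1)‖ :=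
      funext (jacobian_one f)
    rw [this]
    exact (measurable_fderiv_apply_const ℝ f _).norm.aestronglyMeasurable
  · rw [jacobian_one, norm_norm]
    exact norm_partials_le hf u 0

theorem norm_apply_one_le {E : Type*} [NormedAddCommGroup E] [NormedSpace ℝ E]
    (η : E [⋀^Fin 1]→L[ℝ] ℝ) (p : Fin 1 → E) : ‖η p‖ ≤ ‖η‖ * ‖p 0‖ := by
  simpa using η.le_opNorm p

theorem IsRectifiable.mass_ne_top {T : Current 1} (hT : IsRectifiable T) : mass T ≠ ⊤ := by
  obtain ⟨f, θ, hf, hθ, hs, hsum⟩ := hT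
  refine ne_top_of_le_ne_top (ENNReal.ofReal_ne_top (r := ∑' j, ∫ u, |(θ j u : ℝ)| * jacobian (f j) u))
    (mass_le_ofReal fun φ hφ => ?_)
  refine hasSum_le (fun j => ?_) (hsum φ) hs.hasSum
  obtain ⟨K, hK⟩ := hf j
  refine (Real.le_norm_self _).trans (MeasureTheory.norm_integral_le_of_norm_le
    (integrable_mul_jacobian_one hK (hθ j)) (Filter.Eventually.of_forall fun u => ?_))
  rw [norm_mul, Real.norm_eq_abs, jacobian_one]
  gcongr
  refine (norm_apply_one_le _ _).trans ?_
  exact mul_le_of_le_one_left (norm_nonneg _) (hφ _)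

theorem Deformation.isRectifiable_push (h : Deformation) {T : Current 1} (hT : IsRectifiable T) :
    IsRectifiable (h.push T hT.mass_ne_top) := by
  have hm := hT.mass_ne_top
  obtain ⟨f, θ, hf, hθ, hs, hsum⟩ := id hT
  obtain ⟨L, hL, hL'⟩ := h.exists_lipschitz
  have hd : Differentiable ℝ h.toFun := h.contDiff.differentiable (by simp)
  -- By Rademacher's theorem the Lipschitz maps `f j` are differentiable almost everywhere, which is
  -- enough for the chain rule under the integrals.
  have hae : ∀ j, ∀ᵐ u, ∀ a, partials (fun u => h.toFun (f j u)) u a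
      = fderiv ℝ h.toFun (f j u) (partials (f j) u a) := by
    intro j
    obtain ⟨K, hK⟩ := hf j
    filter_upwards [hK.ae_differentiableAt] with u hu a
    rw [partials, fderiv_fun_comp u (hd _) hu]
    rfl
  refine ⟨fun j u => h.toFun (f j u), θ, fun j => ?_, hθ, ?_, fun φ => ?_⟩
  · obtain ⟨K, hK⟩ := hf j
    exact ⟨_, hL.comp hK⟩
  · refine Summable.of_nonneg_of_le (fun j => ?_) (fun j => ?_) (hs.mul_left (L : ℝ))
    · exact MeasureTheory.integral_nonneg fun u =>
        mul_nonneg (abs_nonneg _) (Real.sqrt_nonneg _)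
    · obtain ⟨K, hK⟩ := hf j
      rw [← MeasureTheory.integral_const_mul]
      refine MeasureTheory.integral_mono_ae
        (integrable_mul_jacobian_one (hL.comp hK) (hθ j))
        ((integrable_mul_jacobian_one hK (hθ j)).const_mul _) ?_
      filter_upwards [hae j] with u hu
      rw [jacobian_one, jacobian_one, mul_left_comm]
      refine mul_le_mul_of_nonneg_left ?_ (abs_nonneg _)
      rw [hu]
      exact (fderiv ℝ h.toFun (f j u)).le_of_opNorm_le (hL' _) _
  · rw [h.push_apply]
    convert hsum (h.pullback 1 φ) using 1
    funext j
    refine MeasureTheory.integral_congr_ae ?_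
    filter_upwards [hae j] with u hu
    rw [h.pullback_apply, ContinuousAlternatingMap.compContinuousLinearMap_apply]
    have : partials (fun u => h.toFun (f j u)) u
      = fun a => fderiv ℝ h.toFun (f j u) (partials (f j) u a) := funext hu
    rw [this]
    rfl

/-! ### Finiteness of masses and competitors for the flat norm -/

theorem mass_sub_ne_top {k : ℕ} {T R : Current k} (hT : mass T ≠ ⊤) (hR : mass R ≠ ⊤) :
    mass (T - R) ≠ ⊤ := by
  refine ne_top_of_le_ne_top (ENNReal.ofReal_ne_top (r := (mass T).toReal + (mass R).toReal))
    (mass_le_ofReal fun φ hφ => ?_)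
  have h1 := apply_le_mass_mul hT zero_le_one hφ
  have h2 := apply_le_mass_mul hR (φ := -φ) zero_le_one (fun x => by simpa using hφ x)
  rw [map_neg] at h2
  change T φ - R φ ≤ _
  linarith

theorem mass_zero {k : ℕ} : mass (0 : Current k) = 0 := by
  simp [mass]

theorem flatNorm_le_mass (lam : ℝ≥0) {k : ℕ} (H : Current k) : flatNorm lam H ≤ mass H := by
  refine iInf_le_of_le 0 ?_
  have : boundary (0 : Current (k + 1)) = 0 := rfl
  rw [this, sub_zero, mass_zero, mul_zero, add_zero]

theorem flatNorm_le_mul_mass (lam : ℝ≥0) {k : ℕ} {H : Current k} {S : Current (k + 1)}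
    (h : boundary S = H) : flatNorm lam H ≤ lam * mass S := by
  refine iInf_le_of_le S ?_
  rw [h, sub_self, mass_zero, zero_add]

/-- The zero competitor bounds the flat norm by the finite mass of `M - T`, whereas an infinite mass
of `S`, with `lam > 0`, would make it infinite. -/
theorem IsSpanningMinimalSurface.mass_ne_top {lam : ℝ≥0} (hlam : 0 < lam) {M T : Current 1}
    {S : Current 2} (h : IsSpanningMinimalSurface lam M T S) (hM : IsRectifiable M)
    (hT : IsRectifiable T) : mass S ≠ ⊤ := by
  intro hS
  have h1 := flatNorm_le_mass lam (M - T)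
  rw [h.flatNorm_eq, hS, ENNReal.mul_top (by simpa using hlam.ne'), top_le_iff] at h1
  exact mass_sub_ne_top hM.mass_ne_top hT.mass_ne_top h1

open MeasureTheory Filter

/-! ### Blowing up smooth currents -/

/-- The inclusion of `ℝᵏ` in `ℝ³`, as a continuous linear map. -/
def coordInclCLM (k : ℕ) : EuclideanSpace ℝ (Fin k) →L[ℝ] E3 :=
  LinearMap.toContinuousLinearMap
    { toFun := coordIncl k
      map_add' := fun u v => by
        ext j
        by_cases h : j.1 < k <;> simp [coordIncl, h]
      map_smul' := fun r u => by
        ext j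
        by_cases h : j.1 < k <;> simp [coordIncl, h] }

theorem coordInclCLM_apply {k : ℕ} (u : EuclideanSpace ℝ (Fin k)) :
    coordInclCLM k u = coordIncl k u := rfl

theorem norm_coordIncl {k : ℕ} (hk : k ≤ 3) (u : EuclideanSpace ℝ (Fin k)) :
    ‖coordIncl k u‖ = ‖u‖ := by
  rw [EuclideanSpace.norm_eq, EuclideanSpace.norm_eq]
  congr 1
  interval_cases k <;> simp [coordIncl, Fin.sum_univ_succ]

/-- A smooth chart of space. -/
structure SmoothChart where
  /-- The underlying partial homeomorphism. -/
  toHomeo : OpenPartialHomeomorph E3 E3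
  contDiffOn : ContDiffOn ℝ ∞ toHomeo toHomeo.source
  contDiffOn_symm : ContDiffOn ℝ ∞ toHomeo.symm toHomeo.target

namespace SmoothChart

variable (c : SmoothChart) (k : ℕ)

/-- The parametrization of the submanifold which is flattened by a chart. -/
def param (u : EuclideanSpace ℝ (Fin k)) : E3 := c.toHomeo.symm (coordIncl k u)

/-- The domain of `param`, a relatively open part of a half-space. -/
def dom : Set (EuclideanSpace ℝ (Fin k)) :=
  {u | coordIncl k u ∈ c.toHomeo.target ∧ 0 ≤ coordIncl k u 0}

/-- The derivative of `param`. -/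
def tangentMap (u : EuclideanSpace ℝ (Fin k)) : EuclideanSpace ℝ (Fin k) →L[ℝ] E3 :=
  (fderiv ℝ c.toHomeo.symm (coordIncl k u)).comp (coordInclCLM k)

/-- The coordinate tangent vectors of `param`. -/
def tangent (u : EuclideanSpace ℝ (Fin k)) (a : Fin k) : E3 :=
  c.tangentMap k u (EuclideanSpace.single a 1)

/-- The tangent half-space (or space) of `dom`. -/
def tangentDom (u₀ : EuclideanSpace ℝ (Fin k)) : Set (EuclideanSpace ℝ (Fin k)) :=
  {v | coordIncl k u₀ 0 = 0 → 0 ≤ coordIncl k v 0}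

variable {k} {u₀ : EuclideanSpace ℝ (Fin k)}

theorem measurableSet_dom : MeasurableSet (c.dom k) := by
  have h1 : Continuous (coordIncl k) := (coordInclCLM k).continuous
  have h2 : Continuous fun u => coordIncl k u 0 :=
    (EuclideanSpace.proj (𝕜 := ℝ) (0 : Fin 3)).continuous.comp h1
  exact (c.toHomeo.open_target.preimage h1).measurableSet.inter
    (isClosed_le continuous_const h2).measurableSet

theorem measurableSet_tangentDom : MeasurableSet (tangentDom k u₀) := by
  have h1 : Continuous (coordIncl k) := (coordInclCLM k).continuous
  have h2 : Continuous fun u => coordIncl k u 0 :=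
    (EuclideanSpace.proj (𝕜 := ℝ) (0 : Fin 3)).continuous.comp h1
  by_cases h : coordIncl k u₀ 0 = 0
  · simpa [tangentDom, h] using (isClosed_le continuous_const h2).measurableSet
  · simp [tangentDom, h]

theorem param_mem_source (hu₀ : u₀ ∈ c.dom k) : c.param k u₀ ∈ c.toHomeo.source :=
  c.toHomeo.map_target hu₀.1

theorem apply_param (hu₀ : u₀ ∈ c.dom k) : c.toHomeo (c.param k u₀) = coordIncl k u₀ :=
  c.toHomeo.right_inv hu₀.1

theorem contDiffAt_symm {y : E3} (hy : y ∈ c.toHomeo.target) :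
    ContDiffAt ℝ ∞ c.toHomeo.symm y :=
  c.contDiffOn_symm.contDiffAt (c.toHomeo.open_target.mem_nhds hy)

theorem contDiffAt {y : E3} (hy : y ∈ c.toHomeo.source) : ContDiffAt ℝ ∞ c.toHomeo y :=
  c.contDiffOn.contDiffAt (c.toHomeo.open_source.mem_nhds hy)

theorem continuousAt_fderiv_symm {y : E3} (hy : y ∈ c.toHomeo.target) :
    ContinuousAt (fderiv ℝ c.toHomeo.symm) y :=
  ((c.contDiffAt_symm hy).fderiv_right (m := 0) (by simp)).continuousAt

theorem hasFDerivAt_param (hu₀ : u₀ ∈ c.dom k) :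
    HasFDerivAt (c.param k) (c.tangentMap k u₀) u₀ :=
  HasFDerivAt.comp u₀ (((c.contDiffAt_symm hu₀.1).differentiableAt (by simp)).hasFDerivAt)
    (coordInclCLM k).hasFDerivAt

theorem fderiv_tangentMap (hu₀ : u₀ ∈ c.dom k) (v : EuclideanSpace ℝ (Fin k)) :
    fderiv ℝ c.toHomeo (c.param k u₀) (c.tangentMap k u₀ v) = coordIncl k v := by
  have h1 : HasFDerivAt c.toHomeo.symm (fderiv ℝ c.toHomeo.symm (coordIncl k u₀))
    (coordIncl k u₀) := ((c.contDiffAt_symm hu₀.1).differentiableAt (by simp)).hasFDerivAt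
  have h2 := ((c.contDiffAt (c.param_mem_source hu₀)).differentiableAt (by simp)).hasFDerivAt
  have h3 := HasFDerivAt.comp (coordIncl k u₀) h2 h1
  have h4 : c.toHomeo ∘ c.toHomeo.symm =ᶠ[𝓝 (coordIncl k u₀)] id := by
    filter_upwards [c.toHomeo.open_target.mem_nhds hu₀.1] with y hy
    exact c.toHomeo.right_inv hy
  have h5 := (h3.congr_of_eventuallyEq h4.symm).unique (hasFDerivAt_id _)
  exact DFunLike.congr_fun h5 (coordIncl k v)

theorem tangentMap_injective (hk : k ≤ 3) (hu₀ : u₀ ∈ c.dom k) :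
    Function.Injective (c.tangentMap k u₀) := by
  refine (injective_iff_map_eq_zero _).2 fun v hv => ?_
  have := c.fderiv_tangentMap hu₀ v
  rw [hv, map_zero] at this
  rw [← norm_eq_zero, ← norm_coordIncl hk, ← this, norm_zero]

theorem continuousAt_tangent (hu₀ : u₀ ∈ c.dom k) : ContinuousAt (c.tangent k) u₀ := by
  refine continuousAt_pi.2 fun a => ?_
  have h1 : ContinuousAt (fun u => fderiv ℝ c.toHomeo.symm (coordIncl k u)) u₀ :=
    ContinuousAt.comp (f := coordIncl k) (c.continuousAt_fderiv_symm hu₀.1)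
      (coordInclCLM k).continuous.continuousAt
  exact h1.clm_apply continuousAt_const

/-- The chart is Lipschitz near the base point, so closeness in space forces closeness of
parameters: no distant part of the domain returns to the point. This confines the rescaled integrals
to a bounded set. -/
theorem exists_local_control (hk : k ≤ 3) (hu₀ : u₀ ∈ c.dom k) : ∃ ρ > 0, ∃ K > 0, ∃ B : ℝ,
    ∀ u ∈ c.dom k, ‖c.param k u - c.param k u₀‖ < ρ →
      ‖u - u₀‖ ≤ K * ‖c.param k u - c.param k u₀‖ ∧ ‖c.tangent k u‖ ≤ B := by
  set x := c.param k u₀ with hx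
  have hxs := c.param_mem_source hu₀
  obtain ⟨K, t, ht, hK⟩ := ((c.contDiffAt hxs).of_le (m := 1) (by simp)).exists_lipschitzOnWith
  have h1 : ContinuousAt (fun y => ‖fderiv ℝ c.toHomeo.symm (c.toHomeo y)‖) x := by
    refine (ContinuousAt.comp (f := c.toHomeo) ?_ (c.contDiffAt hxs).continuousAt).norm
    rw [c.apply_param hu₀]
    exact c.continuousAt_fderiv_symm hu₀.1
  set B := ‖fderiv ℝ c.toHomeo.symm (c.toHomeo x)‖ + 1 with hB
  have h2 : ∀ᶠ y in 𝓝 x, ‖fderiv ℝ c.toHomeo.symm (c.toHomeo y)‖ < B :=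
    h1.eventually_lt_const (by simp [hB])
  obtain ⟨ρ, hρ, hρ'⟩ := Metric.mem_nhds_iff.1 (Filter.inter_mem ht h2)
  refine ⟨ρ, hρ, K + 1, by positivity, B, fun u hu hux => ?_⟩
  have hmem := hρ' (show c.param k u ∈ Metric.ball x ρ by rwa [mem_ball_iff_norm])
  have hB2 : ‖fderiv ℝ c.toHomeo.symm (c.toHomeo (c.param k u))‖ < B := hmem.2
  have hxt : x ∈ t := mem_of_mem_nhds ht
  constructor
  · have h3 := hK.norm_sub_le hmem.1 hxt
    rw [c.apply_param hu, hx, c.apply_param hu₀] at h3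
    have h4 : coordIncl k u - coordIncl k u₀ = coordIncl k (u - u₀) :=
      (map_sub (coordInclCLM k) u u₀).symm
    rw [h4, norm_coordIncl hk] at h3
    refine h3.trans ?_
    gcongr
    simp
  · rw [c.apply_param hu] at hB2
    refine (pi_norm_le_iff_of_nonneg ((norm_nonneg _).trans hB2.le)).2 fun a => ?_
    refine (ContinuousLinearMap.le_of_opNorm_le _ hB2.le _).trans ?_
    have h5 : ‖coordInclCLM k (EuclideanSpace.single a 1)‖ = 1 := by
      rw [coordInclCLM_apply, norm_coordIncl hk]
      simp
    exact (congrArg (B * ·) h5).trans_le (mul_one B).le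

/-- The rescaled integrand at scale `ε`, extended by zero. -/
def blowup (f : E3 × (Fin k → E3) → ℝ) (u₀ : EuclideanSpace ℝ (Fin k)) (ε : ℝ) :
    EuclideanSpace ℝ (Fin k) → ℝ :=
  (c.dom k).indicator fun u => f (ε⁻¹ • (c.param k u - c.param k u₀), c.tangent k u)

variable {f : E3 × (Fin k → E3) → ℝ}

theorem measurable_blowup (hf : Continuous f) (ε : ℝ) : Measurable (c.blowup f u₀ ε) := by
  have h : ContinuousOn (fun u => f (ε⁻¹ • (c.param k u - c.param k u₀), c.tangent k u))
      (c.dom k) := by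
    intro u hu
    refine ContinuousAt.continuousWithinAt ?_
    refine hf.continuousAt.comp (ContinuousAt.prodMk ?_ (c.continuousAt_tangent hu))
    exact ((c.hasFDerivAt_param hu).continuousAt.sub continuousAt_const).const_smul ε⁻¹
  classical
  rw [blowup, ← Set.piecewise_eq_indicator]
  exact h.measurable_piecewise continuousOn_const c.measurableSet_dom

/-- The dominating function for the limit. Where the integrand is nonzero the point lies within `ε *
R` of the base point, so `v` has norm at most `K * R` and the arguments of `f` stay in a compact
set. -/
theorem exists_blowup_bound (hk : k ≤ 3) (hu₀ : u₀ ∈ c.dom k) (hf : Continuous f) {R : ℝ}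
    (hR : ∀ z p, R ≤ ‖z‖ → f (z, p) = 0) : ∃ C r : ℝ, 0 ≤ C ∧ ∀ᶠ ε in 𝓝[>] (0 : ℝ), ∀ v,
      ‖c.blowup f u₀ ε (u₀ + ε • v)‖ ≤ (Metric.closedBall 0 r).indicator (fun _ => C) v := by
  obtain ⟨ρ, hρ, K, hK, B, hB⟩ := c.exists_local_control hk hu₀
  set S : Set (E3 × (Fin k → E3)) := Metric.closedBall 0 R ×ˢ Metric.closedBall 0 B
  have hS : IsCompact S := (isCompact_closedBall _ _).prod (isCompact_closedBall _ _)
  obtain ⟨C, hC⟩ := hS.exists_bound_of_continuousOn hf.continuousOn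
  have hρR : ∀ᶠ ε in 𝓝[>] (0 : ℝ), ε * R < ρ := by
    have : Tendsto (fun ε : ℝ => ε * R) (𝓝[>] 0) (𝓝 (0 * R)) :=
      (tendsto_id.mul_const R).mono_left nhdsWithin_le_nhds
    rw [zero_mul] at this
    exact this.eventually_lt_const hρ
  refine ⟨max C 0, K * R, le_max_right _ _, ?_⟩
  filter_upwards [hρR, self_mem_nhdsWithin] with ε hε hε0 v
  rw [Set.mem_Ioi] at hε0
  by_cases hv : c.blowup f u₀ ε (u₀ + ε • v) = 0
  · rw [hv, norm_zero]
    exact Set.indicator_nonneg (fun _ _ => le_max_right _ _) _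
  have hd : u₀ + ε • v ∈ c.dom k := Set.mem_of_indicator_ne_zero hv
  rw [blowup, Set.indicator_of_mem hd] at hv ⊢
  set u := u₀ + ε • v
  have h1 : ‖ε⁻¹ • (c.param k u - c.param k u₀)‖ < R := by
    by_contra hc
    exact hv (hR _ _ (not_lt.1 hc))
  have h2 : ‖c.param k u - c.param k u₀‖ < ε * R := by
    rwa [norm_smul, norm_inv, Real.norm_of_nonneg hε0.le, inv_mul_lt_iff₀ hε0] at h1
  obtain ⟨h3, h4⟩ := hB u hd (h2.trans hε)
  have h5 : v ∈ Metric.closedBall (0 : EuclideanSpace ℝ (Fin k)) (K * R) := by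
    rw [mem_closedBall_zero_iff]
    have h6 : u - u₀ = ε • v := by simp [u]
    rw [h6, norm_smul, Real.norm_of_nonneg hε0.le] at h3
    have h7 : ε * ‖v‖ ≤ ε * (K * R) := h3.trans (by nlinarith)
    exact le_of_mul_le_mul_left h7 hε0
  rw [Set.indicator_of_mem h5]
  refine (hC _ ⟨?_, ?_⟩).trans (le_max_left _ _)
  · simpa using h1.le
  · simpa using h4

theorem integrable_indicator_closedBall (C r : ℝ) : Integrable
    ((Metric.closedBall (0 : EuclideanSpace ℝ (Fin k)) r).indicator fun _ => C) :=
  (integrable_indicator_iff Metric.isClosed_closedBall.measurableSet).2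
    (integrableOn_const (isCompact_closedBall _ _).measure_lt_top.ne)

theorem measurable_affine (u₀ : EuclideanSpace ℝ (Fin k)) (ε : ℝ) :
    Measurable fun v => u₀ + ε • v := by fun_prop

theorem eventually_integrableOn_blowup (hk : k ≤ 3) (hu₀ : u₀ ∈ c.dom k) (hf : Continuous f)
    {R : ℝ} (hR : ∀ z p, R ≤ ‖z‖ → f (z, p) = 0) : ∀ᶠ ε in 𝓝[>] (0 : ℝ), IntegrableOn
      (fun u => f (ε⁻¹ • (c.param k u - c.param k u₀), c.tangent k u)) (c.dom k) := by
  obtain ⟨C, r, hC, h⟩ := c.exists_blowup_bound hk hu₀ hf hR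
  filter_upwards [h, self_mem_nhdsWithin] with ε hε hε0
  rw [← integrable_indicator_iff c.measurableSet_dom]
  have h1 : Integrable fun v => c.blowup f u₀ ε (u₀ + ε • v) :=
    (integrable_indicator_closedBall C r).mono'
      (((c.measurable_blowup hf ε).comp (measurable_affine u₀ ε)).aestronglyMeasurable)
      (Eventually.of_forall hε)
  have h2 := (integrable_comp_smul_iff volume (fun v => c.blowup f u₀ ε (u₀ + v))
    (ne_of_gt hε0)).1 h1
  have h3 := h2.comp_add_left (-u₀)
  simp only [add_neg_cancel_left] at h3
  exact h3

theorem tendsto_add_smul (u₀ v : EuclideanSpace ℝ (Fin k)) :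
    Tendsto (fun ε : ℝ => u₀ + ε • v) (𝓝[>] 0) (𝓝 u₀) := by
  have : Continuous fun ε : ℝ => u₀ + ε • v := by fun_prop
  simpa using (this.tendsto 0).mono_left nhdsWithin_le_nhds

/-- At an edge point the sign condition on the first coordinate is invariant under scaling and
survives. At an interior point it holds automatically at small scale. -/
theorem eventually_mem_dom_iff (hu₀ : u₀ ∈ c.dom k) (v : EuclideanSpace ℝ (Fin k)) :
    ∀ᶠ ε in 𝓝[>] (0 : ℝ), (u₀ + ε • v ∈ c.dom k ↔ v ∈ tangentDom k u₀) := by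
  have hline := tendsto_add_smul u₀ v
  have hincl : Continuous (coordIncl k) := (coordInclCLM k).continuous
  have h0 : Continuous fun u => coordIncl k u 0 :=
    (EuclideanSpace.proj (𝕜 := ℝ) (0 : Fin 3)).continuous.comp hincl
  have hadd : ∀ ε : ℝ, coordIncl k (u₀ + ε • v) 0 = coordIncl k u₀ 0 + ε * coordIncl k v 0 := by
    intro ε
    rw [← coordInclCLM_apply, map_add, map_smul]
    rfl
  have htarget : ∀ᶠ ε in 𝓝[>] (0 : ℝ), coordIncl k (u₀ + ε • v) ∈ c.toHomeo.target :=
    ((hincl.tendsto u₀).comp hline).eventually (c.toHomeo.open_target.mem_nhds hu₀.1)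
  rcases hu₀.2.eq_or_lt with h | h
  · filter_upwards [htarget, self_mem_nhdsWithin] with ε hε hε0
    simp only [dom, tangentDom, Set.mem_ofPred_eq, hε, true_and, hadd, ← h, forall_true_left,
      zero_add]
    exact mul_nonneg_iff_of_pos_left hε0
  · have : ∀ᶠ ε in 𝓝[>] (0 : ℝ), 0 < coordIncl k (u₀ + ε • v) 0 :=
      ((h0.tendsto u₀).comp hline).eventually_const_lt h
    filter_upwards [htarget, this] with ε hε hε0
    simp only [dom, tangentDom, Set.mem_ofPred_eq, hε, true_and, hε0.le, h.ne', false_imp_iff]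

theorem tendsto_slope_param (hu₀ : u₀ ∈ c.dom k) (v : EuclideanSpace ℝ (Fin k)) :
    Tendsto (fun ε : ℝ => ε⁻¹ • (c.param k (u₀ + ε • v) - c.param k u₀)) (𝓝[>] 0)
      (𝓝 (c.tangentMap k u₀ v)) := by
  have := ((c.hasFDerivAt_param hu₀).hasLineDerivAt v).tendsto_slope_zero_right
  simpa using this

theorem tendsto_blowup_integrand (hu₀ : u₀ ∈ c.dom k) (hf : Continuous f)
    (v : EuclideanSpace ℝ (Fin k)) :
    Tendsto (fun ε => c.blowup f u₀ ε (u₀ + ε • v)) (𝓝[>] 0)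
      (𝓝 ((tangentDom k u₀).indicator
        (fun v => f (c.tangentMap k u₀ v, c.tangent k u₀)) v)) := by
  have hdom := c.eventually_mem_dom_iff hu₀ v
  by_cases hv : v ∈ tangentDom k u₀
  · rw [Set.indicator_of_mem hv]
    have h1 := c.tendsto_slope_param hu₀ v
    have h2 : Tendsto (fun ε : ℝ => c.tangent k (u₀ + ε • v)) (𝓝[>] 0) (𝓝 (c.tangent k u₀)) :=
      (c.continuousAt_tangent hu₀).tendsto.comp (tendsto_add_smul u₀ v)
    refine ((hf.tendsto _).comp (h1.prodMk_nhds h2)).congr' ?_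
    filter_upwards [hdom] with ε hε
    rw [blowup, Set.indicator_of_mem (hε.2 hv)]
    rfl
  · rw [Set.indicator_of_notMem hv]
    refine tendsto_const_nhds.congr' ?_
    filter_upwards [hdom] with ε hε
    rw [blowup, Set.indicator_of_notMem (fun h => hv (hε.1 h))]

/-- The integral over a smooth submanifold of an integrand concentrated at scale `ε` around a point
is asymptotic to the integral over the tangent half-space. -/
theorem tendsto_blowup (hk : k ≤ 3) (hu₀ : u₀ ∈ c.dom k) (hf : Continuous f)
    {R : ℝ} (hR : ∀ z p, R ≤ ‖z‖ → f (z, p) = 0) :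
    Tendsto (fun ε : ℝ => (ε ^ k)⁻¹ *
        ∫ u in c.dom k, f (ε⁻¹ • (c.param k u - c.param k u₀), c.tangent k u)) (𝓝[>] 0)
      (𝓝 (∫ v in tangentDom k u₀, f (c.tangentMap k u₀ v, c.tangent k u₀))) := by
  obtain ⟨C, r, hC, h⟩ := c.exists_blowup_bound hk hu₀ hf hR
  rw [← integral_indicator measurableSet_tangentDom]
  have := tendsto_integral_filter_of_dominated_convergence (l := 𝓝[>] (0 : ℝ)) (μ := volume)
    (F := fun ε v => c.blowup f u₀ ε (u₀ + ε • v)) _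
    (Eventually.of_forall fun ε =>
      ((c.measurable_blowup hf ε).comp (measurable_affine u₀ ε)).aestronglyMeasurable)
    (h.mono fun ε hε => Eventually.of_forall hε) (integrable_indicator_closedBall C r)
    (Eventually.of_forall fun v => c.tendsto_blowup_integrand hu₀ hf v)
  refine this.congr' ?_
  filter_upwards [self_mem_nhdsWithin] with ε hε
  rw [Set.mem_Ioi] at hε
  -- The substitution `u = u₀ + ε • v` produces exactly the normalizing factor `(ε ^ k)⁻¹`.
  rw [← integral_indicator c.measurableSet_dom,
    Measure.integral_comp_smul volume (fun v => c.blowup f u₀ ε (u₀ + v)),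
    integral_add_left_eq_self (c.blowup f u₀ ε) u₀, finrank_euclideanSpace_fin, abs_of_pos (by positivity)]
  rfl

end SmoothChart

/-! ### The cross product and two-forms -/

/-- The cross product of `ℝ³`. -/
def cross (p q : E3) : E3 :=
  !₂[p 1 * q 2 - p 2 * q 1, p 2 * q 0 - p 0 * q 2, p 0 * q 1 - p 1 * q 0]

theorem inner_eq_sum (p q : E3) : inner ℝ p q = p 0 * q 0 + p 1 * q 1 + p 2 * q 2 := by
  simp [PiLp.inner_apply, Fin.sum_univ_succ]
  ring

theorem inner_cross_cross (p q r s : E3) : inner ℝ (cross p q) (cross r s)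
    = inner ℝ p r * inner ℝ q s - inner ℝ p s * inner ℝ q r := by
  simp [inner_eq_sum, cross]
  ring

theorem norm_cross_sq (p q : E3) :
    ‖cross p q‖ ^ 2 = ‖p‖ ^ 2 * ‖q‖ ^ 2 - inner ℝ p q ^ 2 := by
  rw [← real_inner_self_eq_norm_sq, inner_cross_cross, real_inner_self_eq_norm_sq,
    real_inner_self_eq_norm_sq, real_inner_comm p q]
  ring

theorem norm_cross_le (p q : E3) : ‖cross p q‖ ≤ ‖p‖ * ‖q‖ := by
  refine abs_le_of_sq_le_sq' ?_ (by positivity) |>.2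
  rw [norm_cross_sq, mul_pow]
  nlinarith [sq_nonneg (inner ℝ p q : ℝ)]

theorem cross_add_left (p q r : E3) : cross (p + q) r = cross p r + cross q r := by
  ext j; fin_cases j <;> simp [cross] <;> ring

theorem cross_add_right (p q r : E3) : cross p (q + r) = cross p q + cross p r := by
  ext j; fin_cases j <;> simp [cross] <;> ring

theorem cross_smul_left (t : ℝ) (p q : E3) : cross (t • p) q = t • cross p q := by
  ext j; fin_cases j <;> simp [cross] <;> ring

theorem cross_smul_right (t : ℝ) (p q : E3) : cross p (t • q) = t • cross p q := by
  ext j; fin_cases j <;> simp [cross] <;> ring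

theorem cross_self (p : E3) : cross p p = 0 := by
  ext j; fin_cases j <;> simp [cross] <;> ring

theorem continuous_cross : Continuous fun p : E3 × E3 => cross p.1 p.2 := by
  refine (PiLp.continuous_toLp 2 _).comp (continuous_pi fun j => ?_)
  fin_cases j <;> simp <;> fun_prop

theorem cross_ne_zero {p q : E3} (h : ∀ s t : ℝ, s • p + t • q = 0 → s = 0 ∧ t = 0) :
    cross p q ≠ 0 := by
  intro h0
  have hq : q ≠ 0 := fun hq => one_ne_zero (h 0 1 (by simp [hq])).2
  have h1 := norm_cross_sq p q
  rw [h0, norm_zero] at h1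
  -- This squared norm equals `‖q‖² ‖cross p q‖²`, so a vanishing cross product yields a linear
  -- relation.
  have h2 : ‖(‖q‖ ^ 2) • p + (-inner ℝ p q : ℝ) • q‖ ^ 2 = 0 := by
    rw [norm_add_sq_real, norm_smul, norm_smul, real_inner_smul_left, real_inner_smul_right,
      Real.norm_eq_abs, Real.norm_eq_abs, mul_pow, mul_pow, sq_abs, sq_abs]
    nlinarith
  have h3 := (h _ _ (norm_eq_zero.1 (pow_eq_zero_iff two_ne_zero |>.1 h2))).1
  exact hq (norm_eq_zero.1 (pow_eq_zero_iff two_ne_zero |>.1 h3))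

/-- The constant two-form with a given normal vector. -/
def crossForm (n : E3) : E3 [⋀^Fin 2]→L[ℝ] ℝ :=
  AlternatingMap.mkContinuous
    { toFun := fun p => inner ℝ n (cross (p 0) (p 1))
      map_update_add' := fun p i a b => by
        fin_cases i <;> simp [cross_add_left, cross_add_right, inner_add_right]
      map_update_smul' := fun p i t a => by
        fin_cases i <;> simp [cross_smul_left, cross_smul_right, inner_smul_right]
      map_eq_zero_of_eq' := fun p i j hij hne => by
        have : p 0 = p 1 := by
          fin_cases i <;> fin_cases j <;> simp_all
        simp [this, cross_self] } ‖n‖ (fun p => by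
      simp only [AlternatingMap.coe_mk, MultilinearMap.coe_mk, Fin.prod_univ_two]
      refine (norm_inner_le_norm _ _).trans ?_
      gcongr
      exact norm_cross_le _ _)

theorem crossForm_apply (n : E3) (p : Fin 2 → E3) :
    crossForm n p = inner ℝ n (cross (p 0) (p 1)) := rfl

theorem norm_crossForm_le (n : E3) : ‖crossForm n‖ ≤ ‖n‖ :=
  AlternatingMap.mkContinuous_norm_le _ (norm_nonneg _) _

/-- Subtracting from `p 1` its component along `p 0` changes neither side, and for an orthogonal
pair the area is the product of the lengths. The sharp area factor is needed for the first
variation. -/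
theorem apply_two_le (η : E3 [⋀^Fin 2]→L[ℝ] ℝ) (p : Fin 2 → E3) :
    ‖η p‖ ≤ ‖η‖ * ‖cross (p 0) (p 1)‖ := by
  by_cases h0 : p 0 = 0
  · rw [η.map_coord_zero 0 h0, norm_zero]
    positivity
  set t : ℝ := -(inner ℝ (p 0) (p 1) / ‖p 0‖ ^ 2) with ht
  set q : E3 := p 1 + t • p 0 with hq
  have hn : ‖p 0‖ ^ 2 ≠ 0 := pow_ne_zero _ (norm_ne_zero_iff.2 h0)
  have h1 : η p = η ![p 0, q] := by
    have h2 : ![p 0, q] = Function.update p 1 q := by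
      ext j; fin_cases j <;> simp
    have h3 : Function.update p 1 (p 0) 0 = Function.update p 1 (p 0) 1 := by simp
    have h4 : Function.update p 1 (p 1) = p := by simp
    rw [h2, hq, η.map_update_add, η.map_update_smul, η.map_eq_zero_of_eq _ h3 (by simp), h4]
    simp
  have h5 : cross (p 0) q = cross (p 0) (p 1) := by
    rw [hq, cross_add_right, cross_smul_right, cross_self]
    simp
  have h6 : inner ℝ (p 0) q = (0 : ℝ) := by
    rw [hq, inner_add_right, inner_smul_right, real_inner_self_eq_norm_sq, ht]
    field_simp
    ring
  have h7 : ‖cross (p 0) (p 1)‖ = ‖p 0‖ * ‖q‖ := by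
    have := norm_cross_sq (p 0) q
    rw [h5, h6, ← mul_pow] at this
    simpa using (pow_left_inj₀ (norm_nonneg _) (by positivity) two_ne_zero).1
      (this.trans (by simp))
  rw [h1, h7]
  simpa using η.le_opNorm ![p 0, q]

/-- From `2 ‖ξ‖ ‖ξ + τ • η‖ ≤ ‖ξ‖² + ‖ξ + τ • η‖²`. The linear term is exact and the quadratic
remainder holds for every `τ`. -/
theorem norm_add_smul_le {ξ η : E3} (hξ : ξ ≠ 0) (τ : ℝ) : ‖ξ + τ • η‖ ≤
    ‖ξ‖ + τ * (inner ℝ ξ η / ‖ξ‖) + τ ^ 2 * (‖η‖ ^ 2 / (2 * ‖ξ‖)) := by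
  have h : 0 < ‖ξ‖ := norm_pos_iff.2 hξ
  have h1 : ‖ξ + τ • η‖ ^ 2 = ‖ξ‖ ^ 2 + 2 * τ * inner ℝ ξ η + τ ^ 2 * ‖η‖ ^ 2 := by
    rw [norm_add_sq_real, inner_smul_right, norm_smul, mul_pow, Real.norm_eq_abs, sq_abs]
    ring
  have h2 : 2 * ‖ξ‖ * ‖ξ + τ • η‖ ≤ ‖ξ‖ ^ 2 + ‖ξ + τ • η‖ ^ 2 := two_mul_le_add_sq _ _
  have h3 : ‖ξ + τ • η‖ ≤ (‖ξ‖ ^ 2 + ‖ξ + τ • η‖ ^ 2) / (2 * ‖ξ‖) := by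
    rw [le_div_iff₀ (by positivity)]
    linarith
  refine h3.trans_eq ?_
  rw [h1]
  field_simp
  ring

/-! ### Test forms concentrated around a point -/

section Scaled

variable {k : ℕ}

theorem tsupport_scaled_subset {F : Type*} [Zero F] {g : E3 → F} {R : ℝ}
    (hR : ∀ z, R < ‖z‖ → g z = 0) (x : E3) {ε : ℝ} (hε : 0 < ε) :
    tsupport (fun y => g (ε⁻¹ • (y - x))) ⊆ Metric.closedBall x (ε * R) := by
  refine closure_minimal (fun y hy => ?_) Metric.isClosed_closedBall
  by_contra hc
  refine hy (hR _ ?_)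
  rw [mem_closedBall_iff_norm, not_le] at hc
  rwa [norm_smul, norm_inv, Real.norm_of_nonneg hε.le, lt_inv_mul_iff₀ hε]

theorem contDiff_scaled {F : Type*} [NormedAddCommGroup F] [NormedSpace ℝ F] {g : E3 → F}
    (hg : ContDiff ℝ ∞ g) (x : E3) (ε : ℝ) : ContDiff ℝ ∞ fun y => g (ε⁻¹ • (y - x)) :=
  hg.comp ((contDiff_id.sub contDiff_const).const_smul ε⁻¹)

theorem fderiv_scaled {F : Type*} [NormedAddCommGroup F] [NormedSpace ℝ F] {g : E3 → F}
    (hg : Differentiable ℝ g) (x : E3) (ε : ℝ) (y v : E3) :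
    fderiv ℝ (fun y => g (ε⁻¹ • (y - x))) y v = ε⁻¹ • fderiv ℝ g (ε⁻¹ • (y - x)) v := by
  have h1 : HasFDerivAt (fun y : E3 => ε⁻¹ • (y - x)) (ε⁻¹ • ContinuousLinearMap.id ℝ E3) y :=
    ((hasFDerivAt_id y).sub_const x).const_smul ε⁻¹
  have h2 := HasFDerivAt.comp y (hg (ε⁻¹ • (y - x))).hasFDerivAt h1
  have h3 : (fun y => g (ε⁻¹ • (y - x))) = g ∘ fun y => ε⁻¹ • (y - x) := rfl
  rw [h3, h2.fderiv]
  simp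

/-- The form `ψ((y - x) / ε) η` with constant coefficients `η`. -/
def scaledForm {ψ : E3 → ℝ} (hψ : ContDiff ℝ ∞ ψ) {R : ℝ} (hR : ∀ z, R < ‖z‖ → ψ z = 0)
    (η : E3 [⋀^Fin k]→L[ℝ] ℝ) (x : E3) {ε : ℝ} (hε : 0 < ε) : Form k where
  toFun y := ψ (ε⁻¹ • (y - x)) • η
  contDiff' := (contDiff_scaled hψ x ε).smul contDiff_const
  hasCompactSupport' := by
    have : HasCompactSupport fun y => ψ (ε⁻¹ • (y - x)) :=
      (isCompact_closedBall x (ε * R)).of_isClosed_subset (isClosed_tsupport _)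
        (tsupport_scaled_subset hR x hε)
    exact this.smul_right
  tsupport_subset' := fun _ _ => trivial

variable {ψ : E3 → ℝ} (hψ : ContDiff ℝ ∞ ψ) {R : ℝ} (hR : ∀ z, R < ‖z‖ → ψ z = 0)
  (η : E3 [⋀^Fin k]→L[ℝ] ℝ) (x : E3) {ε : ℝ} (hε : 0 < ε)

theorem scaledForm_apply (y : E3) :
    scaledForm hψ hR η x hε y = ψ (ε⁻¹ • (y - x)) • η := rfl

theorem tsupport_scaledForm_subset :
    tsupport (scaledForm hψ hR η x hε) ⊆ Metric.closedBall x (ε * R) :=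
  tsupport_scaled_subset (g := fun z => ψ z • η) (fun z hz => by simp [hR z hz]) x hε

/-- The value of the exterior derivative of `ψ η` on a tuple of vectors. -/
def dForm (ψ : E3 → ℝ) (η : E3 [⋀^Fin k]→L[ℝ] ℝ) (q : E3 × (Fin (k + 1) → E3)) : ℝ :=
  ∑ i : Fin (k + 1), (-1) ^ i.val * (fderiv ℝ ψ q.1 (q.2 i) * η (i.removeNth q.2))

theorem extD_scaledForm (y : E3) (p : Fin (k + 1) → E3) :
    extD k (scaledForm hψ hR η x hε) y p = ε⁻¹ * dForm ψ η (ε⁻¹ • (y - x), p) := by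
  have hd : Differentiable ℝ fun y => ψ (ε⁻¹ • (y - x)) :=
    (contDiff_scaled hψ x ε).differentiable (by simp)
  rw [extD_apply, extDeriv_apply, dForm, Finset.mul_sum]
  · refine Finset.sum_congr rfl fun i _ => ?_
    have : (fun y => scaledForm hψ hR η x hε y (i.removeNth p))
        = fun y => ψ (ε⁻¹ • (y - x)) * η (i.removeNth p) := rfl
    rw [this, fderiv_mul_const (hd y)]
    rw [_root_.smul_apply, fderiv_scaled (hψ.differentiable (by simp))]
    simp only [smul_eq_mul]
    ring
  · exact (scaledForm hψ hR η x hε).contDiff.differentiable (by simp) y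

include hψ in
theorem continuous_dForm : Continuous (dForm ψ η) := by
  have h : Continuous (fderiv ℝ ψ) := hψ.continuous_fderiv (by simp)
  refine continuous_finsetSum _ fun i _ => continuous_const.mul (Continuous.mul ?_ ?_)
  · exact (h.comp continuous_fst).clm_apply ((continuous_apply i).comp continuous_snd)
  · refine η.cont.comp (continuous_pi fun j => ?_)
    exact (continuous_apply _).comp continuous_snd

include hR in
theorem dForm_eq_zero {z : E3} (hz : R < ‖z‖) (p : Fin (k + 1) → E3) : dForm ψ η (z, p) = 0 := by
  have h : ψ =ᶠ[𝓝 z] fun _ => 0 := by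
    filter_upwards [continuous_norm.continuousAt.eventually_const_lt hz] with y hy
    exact hR y hy
  simp [dForm, h.fderiv_eq]

end Scaled

/-! ### Integrals over half-spaces -/

section Line

variable {V : Type*} [NormedAddCommGroup V] [NormedSpace ℝ V]

theorem isClosedEmbedding_line (w : V) {e : V} (he : e ≠ 0) :
    Topology.IsClosedEmbedding fun t : ℝ => w + t • e := by
  have h1 : Topology.IsClosedEmbedding fun t : ℝ => t • e :=
    isClosedEmbedding_smul_left he
  exact (Homeomorph.addLeft w).isClosedEmbedding.comp h1

variable {g : V → ℝ} (hg : ContDiff ℝ 1 g) (hgc : HasCompactSupport g) (w : V) {e : V}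

include hg in
theorem deriv_line (t : ℝ) : deriv (fun t : ℝ => g (w + t • e)) t = fderiv ℝ g (w + t • e) e := by
  have h1 : HasDerivAt (fun t : ℝ => w + t • e) e t := by
    simpa using ((hasDerivAt_id t).smul_const e).const_add w
  exact ((hg.differentiable one_ne_zero _).hasFDerivAt.comp_hasDerivAt t h1).deriv

include hg in
theorem contDiff_line (e : V) : ContDiff ℝ 1 fun t : ℝ => g (w + t • e) :=
  hg.comp (contDiff_const.add (contDiff_id.smul contDiff_const))

include hg hgc in
theorem integral_Ici_fderiv_line (he : e ≠ 0) :
    ∫ t in Set.Ici (0 : ℝ), fderiv ℝ g (w + t • e) e = -g w := by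
  have h := HasCompactSupport.integral_Ioi_deriv_eq (contDiff_line hg w e)
    (hgc.comp_isClosedEmbedding (isClosedEmbedding_line w he)) 0
  simp only [deriv_line hg, zero_smul, add_zero] at h
  rw [integral_Ici_eq_integral_Ioi, h]

include hg hgc in
theorem integral_fderiv_line (he : e ≠ 0) : ∫ t : ℝ, fderiv ℝ g (w + t • e) e = 0 := by
  have hc := hgc.comp_isClosedEmbedding (isClosedEmbedding_line w he)
  have hd := contDiff_line hg w e
  have h1 := HasCompactSupport.integral_Ioi_deriv_eq hd hc 0
  have h2 := HasCompactSupport.integral_Iic_deriv_eq hd hc 0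
  have hi : Integrable (deriv fun t : ℝ => g (w + t • e)) :=
    (hd.continuous_deriv le_rfl).integrable_of_hasCompactSupport hc.deriv
  have h3 := integral_add_compl (measurableSet_Iic (a := (0 : ℝ))) hi
  rw [Set.compl_Iic, h1, h2, add_neg_cancel] at h3
  simpa only [deriv_line hg] using h3.symm

end Line

/-- The point of the coordinate plane with given coordinates. -/
def planePoint (p : ℝ × ℝ) : EuclideanSpace ℝ (Fin 2) :=
  p.1 • EuclideanSpace.single 0 1 + p.2 • EuclideanSpace.single 1 1

theorem planePoint_apply_zero (p : ℝ × ℝ) : planePoint p 0 = p.1 := by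
  simp [planePoint]

theorem planePoint_eq (p : ℝ × ℝ) : planePoint p = WithLp.toLp 2 ![p.1, p.2] := by
  ext j
  fin_cases j <;> simp [planePoint]

theorem isClosedEmbedding_planePoint : Topology.IsClosedEmbedding planePoint := by
  have h1 : planePoint = (PiLp.homeomorph 2 fun _ : Fin 2 => ℝ).symm
      ∘ (Homeomorph.finTwoArrow (X := ℝ)).symm := by
    funext p
    rw [planePoint_eq]
    rfl
  rw [h1]
  exact (Homeomorph.isClosedEmbedding _).comp (Homeomorph.isClosedEmbedding _)

theorem measurePreserving_planePoint : MeasurePreserving planePoint := by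
  have h1 : planePoint = (WithLp.toLp 2 : (Fin 2 → ℝ) → EuclideanSpace ℝ (Fin 2))
      ∘ (MeasurableEquiv.finTwoArrow (α := ℝ)).symm := by
    funext p
    rw [planePoint_eq]
    rfl
  rw [h1]
  exact (PiLp.volume_preserving_toLp (Fin 2)).comp (volume_preserving_finTwoArrow ℝ).symm

theorem setIntegral_plane (G : EuclideanSpace ℝ (Fin 2) → ℝ) (s : Set ℝ) :
    ∫ v in {v : EuclideanSpace ℝ (Fin 2) | v 0 ∈ s}, G v
      = ∫ p in s ×ˢ Set.univ, G (planePoint p) := by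
  have h := measurePreserving_planePoint.setIntegral_preimage_emb
    isClosedEmbedding_planePoint.measurableEmbedding G {v | v 0 ∈ s}
  rw [← h]
  congr 2
  ext p
  simp [planePoint_apply_zero]

section Plane

variable {G : EuclideanSpace ℝ (Fin 2) → ℝ} (hG : ContDiff ℝ 1 G) (hGc : HasCompactSupport G)

include hG hGc in
theorem integrable_fderiv_planePoint (e : EuclideanSpace ℝ (Fin 2)) :
    Integrable fun p => fderiv ℝ G (planePoint p) e := by
  refine Continuous.integrable_of_hasCompactSupport ?_ ?_
  · exact ((hG.continuous_fderiv one_ne_zero).comp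
      isClosedEmbedding_planePoint.continuous).clm_apply continuous_const
  · exact ((hGc.fderiv_apply ℝ e).comp_isClosedEmbedding isClosedEmbedding_planePoint)

-- The second coordinate is unrestricted, so integrating along it first gives zero whatever the
-- condition on the first.
include hG hGc in
theorem setIntegral_fderiv_single_one (s : Set ℝ) :
    ∫ v in {v : EuclideanSpace ℝ (Fin 2) | v 0 ∈ s},
      fderiv ℝ G v (EuclideanSpace.single 1 1) = 0 := by
  rw [setIntegral_plane, Measure.volume_eq_prod, setIntegral_prod _
    (by rw [← Measure.volume_eq_prod]; exact (integrable_fderiv_planePoint hG hGc _).integrableOn)]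
  simp only [Measure.restrict_univ, planePoint]
  simp [integral_fderiv_line hG hGc]

include hG hGc in
theorem integral_fderiv_single_zero :
    ∫ v : EuclideanSpace ℝ (Fin 2), fderiv ℝ G v (EuclideanSpace.single 0 1) = 0 := by
  have h := setIntegral_plane (fun v => fderiv ℝ G v (EuclideanSpace.single 0 1)) Set.univ
  simp only [Set.mem_univ, Set.univ_prod_univ, Set.ofPred_true, Measure.restrict_univ] at h
  rw [h, Measure.volume_eq_prod, integral_prod_symm _
    (by rw [← Measure.volume_eq_prod]; exact integrable_fderiv_planePoint hG hGc _)]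
  simp only [planePoint, add_comm _ (_ • EuclideanSpace.single (1 : Fin 2) (1 : ℝ))]
  simp [integral_fderiv_line hG hGc]

-- The divergence theorem on a half-plane: integrating the transversal derivative over `[0, ∞)`
-- leaves the value on the edge, with a minus sign.
include hG hGc in
theorem setIntegral_fderiv_single_zero :
    ∫ v in {v : EuclideanSpace ℝ (Fin 2) | v 0 ∈ Set.Ici 0},
      fderiv ℝ G v (EuclideanSpace.single 0 1) = -∫ t : ℝ, G (t • EuclideanSpace.single 1 1) := by
  rw [setIntegral_plane, Measure.volume_eq_prod, ← Measure.prod_restrict, integral_prod_symm _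
    (by
      rw [Measure.prod_restrict, ← Measure.volume_eq_prod]
      exact (integrable_fderiv_planePoint hG hGc _).integrableOn)]
  simp only [planePoint, add_comm _ (_ • EuclideanSpace.single (1 : Fin 2) (1 : ℝ)),
    Measure.restrict_univ]
  simp [integral_Ici_fderiv_line hG hGc, integral_neg]

end Plane

/-- The point of the coordinate line with a given coordinate. -/
def linePoint (t : ℝ) : EuclideanSpace ℝ (Fin 1) := t • EuclideanSpace.single 0 1

theorem measurePreserving_linePoint : MeasurePreserving linePoint := by
  have h1 : linePoint = (WithLp.toLp 2 : (Fin 1 → ℝ) → EuclideanSpace ℝ (Fin 1))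
      ∘ (MeasurableEquiv.funUnique (Fin 1) ℝ).symm := by
    funext p
    ext j
    fin_cases j
    simp [linePoint]
  rw [h1]
  exact (PiLp.volume_preserving_toLp (Fin 1)).comp (volume_preserving_funUnique (Fin 1) ℝ).symm

theorem isClosedEmbedding_linePoint : Topology.IsClosedEmbedding linePoint :=
  isClosedEmbedding_smul_left (by simp)

theorem setIntegral_line (G : EuclideanSpace ℝ (Fin 1) → ℝ) (s : Set ℝ) :
    ∫ v in {v : EuclideanSpace ℝ (Fin 1) | v 0 ∈ s}, G v = ∫ t in s, G (linePoint t) := by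
  have h := measurePreserving_linePoint.setIntegral_preimage_emb
    isClosedEmbedding_linePoint.measurableEmbedding G {v | v 0 ∈ s}
  rw [← h]
  congr 2
  ext p
  simp [linePoint]

/-! ### Supports and tangent cones of smooth currents -/

theorem eventually_closedBall_subset {x : E3} {s : Set E3} (hs : s ∈ 𝓝 x) (R : ℝ) :
    ∀ᶠ ε in 𝓝[>] (0 : ℝ), Metric.closedBall x (ε * R) ⊆ s := by
  obtain ⟨ρ, hρ, hρ'⟩ := Metric.mem_nhds_iff.1 hs
  have : Tendsto (fun ε : ℝ => ε * R) (𝓝[>] 0) (𝓝 (0 * R)) :=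
    (tendsto_id.mul_const R).mono_left nhdsWithin_le_nhds
  rw [zero_mul] at this
  filter_upwards [this.eventually_lt_const hρ] with ε hε
  exact (Metric.closedBall_subset_ball hε).trans hρ'

/-- `ψ` is a smooth function supported in the ball of radius `R`. -/
structure IsBump (ψ : E3 → ℝ) (R : ℝ) : Prop where
  contDiff : ContDiff ℝ ∞ ψ
  eq_zero : ∀ z, R < ‖z‖ → ψ z = 0

theorem IsBump.hasCompactSupport {ψ : E3 → ℝ} {R : ℝ} (h : IsBump ψ R) : HasCompactSupport ψ :=
  HasCompactSupport.intro (isCompact_closedBall 0 R) fun z hz =>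
    h.eq_zero z (by simpa using hz)

/-- A nonnegative bump function which is positive at the origin and equal to one near it. -/
theorem exists_isBump {r : ℝ} (hr : 0 < r) : ∃ ψ : E3 → ℝ, IsBump ψ (r + 1) ∧ (∀ z, 0 ≤ ψ z) ∧
    (∀ z, ψ z ≤ 1) ∧ ∀ z, ‖z‖ ≤ r → ψ z = 1 := by
  let ψ : ContDiffBump (0 : E3) := ⟨r, r + 1, hr, by linarith⟩
  refine ⟨ψ, ⟨ψ.contDiff, fun z hz => ψ.zero_of_le_dist ?_⟩, fun z => ψ.nonneg,
    fun z => ψ.le_one, fun z hz => ψ.one_of_mem_closedBall (by simpa using hz)⟩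
  simpa using hz.le

namespace SmoothChart

variable (c : SmoothChart) {k : ℕ} {u₀ : EuclideanSpace ℝ (Fin k)} {m : ℤ}

/-- Near `c.toHomeo.source` the current `T` is integration over the submanifold flattened by `c`,
with multiplicity `m`. -/
def Represents (m : ℤ) (T : Current k) : Prop :=
  ∀ φ : Form k, tsupport φ ⊆ c.toHomeo.source →
    T φ = (m : ℝ) * ∫ u in c.dom k, φ (c.param k u) (c.tangent k u)

variable {c}

theorem Represents.apply_scaledForm {T : Current k} (hT : c.Represents m T) (hu₀ : u₀ ∈ c.dom k)
    {ψ : E3 → ℝ} {R : ℝ} (hψ : IsBump ψ R) (η : E3 [⋀^Fin k]→L[ℝ] ℝ) :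
    ∀ᶠ ε in 𝓝[>] (0 : ℝ), ∀ hε : 0 < ε,
      T (scaledForm hψ.contDiff hψ.eq_zero η (c.param k u₀) hε) = m * ∫ u in c.dom k,
        ψ (ε⁻¹ • (c.param k u - c.param k u₀)) * η (c.tangent k u) := by
  filter_upwards [eventually_closedBall_subset
    (c.toHomeo.open_source.mem_nhds (c.param_mem_source hu₀)) R] with ε hs hε
  rw [hT _ ((tsupport_scaledForm_subset _ _ _ _ hε).trans hs)]
  rfl

theorem Represents.apply_extD_scaledForm {T : Current (k + 1)} {u₀ : EuclideanSpace ℝ (Fin (k + 1))}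
    (hT : c.Represents m T) (hu₀ : u₀ ∈ c.dom (k + 1)) {ψ : E3 → ℝ} {R : ℝ} (hψ : IsBump ψ R)
    (η : E3 [⋀^Fin k]→L[ℝ] ℝ) :
    ∀ᶠ ε in 𝓝[>] (0 : ℝ), ∀ hε : 0 < ε,
      boundary T (scaledForm hψ.contDiff hψ.eq_zero η (c.param (k + 1) u₀) hε)
        = m * (ε⁻¹ * ∫ u in c.dom (k + 1), dForm ψ η
          (ε⁻¹ • (c.param (k + 1) u - c.param (k + 1) u₀), c.tangent (k + 1) u)) := by
  filter_upwards [eventually_closedBall_subset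
    (c.toHomeo.open_source.mem_nhds (c.param_mem_source hu₀)) R] with ε hs hε
  rw [boundary_apply, hT]
  · simp only [extD_scaledForm, integral_const_mul]
  · refine (closure_minimal (fun y hy => ?_) Metric.isClosed_closedBall).trans hs
    by_contra hc
    refine hy ?_
    ext p
    rw [extD_scaledForm, dForm_eq_zero hψ.eq_zero, mul_zero]
    · rfl
    · rw [mem_closedBall_iff_norm, not_le] at hc
      rwa [norm_smul, norm_inv, Real.norm_of_nonneg hε.le, lt_inv_mul_iff₀ hε]

theorem tendsto_scaledForm (hk : k ≤ 3) (hu₀ : u₀ ∈ c.dom k) {ψ : E3 → ℝ} {R : ℝ}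
    (hψ : IsBump ψ R) (η : E3 [⋀^Fin k]→L[ℝ] ℝ) :
    Tendsto (fun ε : ℝ => (ε ^ k)⁻¹ * ∫ u in c.dom k,
        ψ (ε⁻¹ • (c.param k u - c.param k u₀)) * η (c.tangent k u)) (𝓝[>] 0)
      (𝓝 ((∫ v in tangentDom k u₀, ψ (c.tangentMap k u₀ v)) * η (c.tangent k u₀))) := by
  rw [← integral_mul_const]
  refine c.tendsto_blowup hk hu₀ (f := fun q => ψ q.1 * η q.2) (R := R + 1) ?_ ?_
  · exact (hψ.contDiff.continuous.comp continuous_fst).mul (η.cont.comp continuous_snd)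
  · intro z p hz
    simp [hψ.eq_zero z (by linarith)]

theorem tendsto_dForm {u₀ : EuclideanSpace ℝ (Fin (k + 1))} (hk : k + 1 ≤ 3)
    (hu₀ : u₀ ∈ c.dom (k + 1)) {ψ : E3 → ℝ} {R : ℝ} (hψ : IsBump ψ R)
    (η : E3 [⋀^Fin k]→L[ℝ] ℝ) :
    Tendsto (fun ε : ℝ => (ε ^ k)⁻¹ * (ε⁻¹ * ∫ u in c.dom (k + 1), dForm ψ η
        (ε⁻¹ • (c.param (k + 1) u - c.param (k + 1) u₀), c.tangent (k + 1) u))) (𝓝[>] 0)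
      (𝓝 (∫ v in tangentDom (k + 1) u₀,
        dForm ψ η (c.tangentMap (k + 1) u₀ v, c.tangent (k + 1) u₀))) := by
  refine (c.tendsto_blowup hk hu₀ (R := R + 1) (continuous_dForm hψ.contDiff η) ?_).congr
    fun ε => ?_
  · intro z p hz
    exact dForm_eq_zero hψ.eq_zero η (by linarith) p
  · rw [pow_succ, mul_inv, mul_assoc]

theorem isClosedEmbedding_tangentMap (hk : k ≤ 3) (hu₀ : u₀ ∈ c.dom k) :
    Topology.IsClosedEmbedding (c.tangentMap k u₀) :=
  LinearMap.isClosedEmbedding_of_injective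
    (LinearMap.ker_eq_bot.2 (c.tangentMap_injective hk hu₀))

theorem setIntegral_bump_pos (hk0 : 0 < k) (hk : k ≤ 3) (hu₀ : u₀ ∈ c.dom k) {ψ : E3 → ℝ} {R : ℝ}
    (hψ : IsBump ψ R) (h0 : ∀ z, 0 ≤ ψ z) (h1 : ψ 0 = 1) :
    0 < ∫ v in tangentDom k u₀, ψ (c.tangentMap k u₀ v) := by
  have hcont : Continuous fun v => ψ (c.tangentMap k u₀ v) :=
    hψ.contDiff.continuous.comp (c.tangentMap k u₀).continuous
  have hint : Integrable fun v => ψ (c.tangentMap k u₀ v) :=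
    hcont.integrable_of_hasCompactSupport
      (hψ.hasCompactSupport.comp_isClosedEmbedding (isClosedEmbedding_tangentMap hk hu₀))
  rw [setIntegral_pos_iff_support_of_nonneg_ae
    (Eventually.of_forall fun v => h0 _) hint.integrableOn]
  have hincl : Continuous fun v : EuclideanSpace ℝ (Fin k) => coordIncl k v 0 :=
    (EuclideanSpace.proj (𝕜 := ℝ) (0 : Fin 3)).continuous.comp (coordInclCLM k).continuous
  set O : Set (EuclideanSpace ℝ (Fin k)) :=
    {v | 0 < ψ (c.tangentMap k u₀ v)} ∩ {v | 0 < coordIncl k v 0} with hO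
  have hopen : IsOpen O :=
    (isOpen_lt continuous_const hcont).inter (isOpen_lt continuous_const hincl)
  have hne : O.Nonempty := by
    set e : EuclideanSpace ℝ (Fin k) := EuclideanSpace.single ⟨0, hk0⟩ 1
    have hline : Tendsto (fun t : ℝ => t • e) (𝓝[>] 0) (𝓝 0) := by
      simpa using tendsto_add_smul 0 e
    have h2 : ∀ᶠ t : ℝ in 𝓝[>] 0, 0 < ψ (c.tangentMap k u₀ (t • e)) := by
      refine ((hcont.tendsto 0).comp hline).eventually_const_lt ?_
      simp [h1]
    obtain ⟨t, ht, ht0⟩ := (h2.and self_mem_nhdsWithin).exists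
    refine ⟨t • e, ht, ?_⟩
    simpa [coordIncl, hk0, e] using ht0
  refine (hopen.measure_pos volume hne).trans_le (measure_mono fun v hv => ⟨?_, fun _ => ?_⟩)
  · exact hv.1.ne'
  · exact hv.2.le

/-- If `T` vanished near the point, its values on concentrated bumps would be zero. Divided by `ε ^
k` they converge to `m` times a positive integral times `η` of the tangent vectors. -/
theorem Represents.param_mem_supp {T : Current k} (hT : c.Represents m T) (hm : m ≠ 0)
    (hk0 : 0 < k) (hk : k ≤ 3) (hu₀ : u₀ ∈ c.dom k) {η : E3 [⋀^Fin k]→L[ℝ] ℝ}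
    (hη : η (c.tangent k u₀) ≠ 0) : c.param k u₀ ∈ supp T := by
  by_contra hc
  obtain ⟨s, hs, hso, hxs⟩ := (Distribution.notMem_dsupport_iff _).1 hc
  obtain ⟨ψ, hψ, h0, -, h1⟩ := exists_isBump zero_lt_one
  have hlim := (tendsto_scaledForm hk hu₀ hψ η).const_mul (m : ℝ)
  have hzero : (fun ε : ℝ => (m : ℝ) * ((ε ^ k)⁻¹ * ∫ u in c.dom k,
      ψ (ε⁻¹ • (c.param k u - c.param k u₀)) * η (c.tangent k u))) =ᶠ[𝓝[>] 0] fun _ => 0 := by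
    filter_upwards [hT.apply_scaledForm hu₀ hψ η, self_mem_nhdsWithin,
      eventually_closedBall_subset (hso.mem_nhds hxs) (1 + 1)] with ε h2 hε h3
    have h4 := hs _ ((tsupport_scaledForm_subset hψ.contDiff hψ.eq_zero η _ hε).trans h3)
    rw [mul_left_comm, ← h2 hε]
    exact mul_eq_zero_of_right _ h4
  have := tendsto_nhds_unique hlim (tendsto_const_nhds.congr' hzero.symm)
  refine mul_ne_zero (by exact_mod_cast hm) (mul_ne_zero ?_ hη) this
  exact (setIntegral_bump_pos hk0 hk hu₀ hψ h0 (h1 0 (by simp))).ne'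

/-- The model half-space is closed, so a point of the source off the submanifold has a neighbourhood
that the submanifold does not meet, and there `T` vanishes. -/
theorem Represents.exists_param_eq {T : Current k} (hT : c.Represents m T) (hk : k ≤ 3) {y : E3}
    (hy : y ∈ supp T) (hys : y ∈ c.toHomeo.source) : ∃ u ∈ c.dom k, c.param k u = y := by
  by_contra hc
  push Not at hc
  have hincl : Continuous fun v : EuclideanSpace ℝ (Fin k) => coordIncl k v 0 :=
    (EuclideanSpace.proj (𝕜 := ℝ) (0 : Fin 3)).continuous.comp (coordInclCLM k).continuous
  have hemb : Topology.IsClosedEmbedding (coordInclCLM k) := by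
    refine LinearMap.isClosedEmbedding_of_injective (LinearMap.ker_eq_bot'.2 fun v hv => ?_)
    rw [← norm_eq_zero, ← norm_coordIncl hk]
    exact norm_eq_zero.2 hv
  set Q : Set E3 := coordIncl k '' {v | 0 ≤ coordIncl k v 0} with hQ
  have hQc : IsClosed Q := hemb.isClosedMap _ (isClosed_le continuous_const hincl)
  set Z : Set E3 := c.toHomeo.source ∩ c.toHomeo ⁻¹' Qᶜ
  have hZo : IsOpen Z := c.toHomeo.isOpen_inter_preimage hQc.isOpen_compl
  have hyZ : y ∈ Z := by
    refine ⟨hys, ?_⟩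
    rintro ⟨v, hv, hvy⟩
    refine hc v ⟨?_, hv⟩ ?_
    · rw [hvy]
      exact c.toHomeo.map_source hys
    · rw [param, hvy, c.toHomeo.left_inv hys]
  refine (Distribution.notMem_dsupport_iff y).2 ⟨Z, fun φ hφ => ?_, hZo, hyZ⟩ hy
  rw [hT φ (hφ.trans Set.inter_subset_left), setIntegral_eq_zero_of_forall_eq_zero, mul_zero]
  intro u hu
  have : φ (c.param k u) = 0 := by
    refine image_eq_zero_of_notMem_tsupport fun h => ?_
    refine (hφ h).2 ?_
    rw [c.apply_param hu]
    exact ⟨u, hu.2, rfl⟩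
  rw [this]
  rfl

theorem fderiv_symm_fderiv (hu₀ : u₀ ∈ c.dom k) (y : E3) :
    fderiv ℝ c.toHomeo.symm (coordIncl k u₀) (fderiv ℝ c.toHomeo (c.param k u₀) y) = y := by
  have h1 : HasFDerivAt c.toHomeo.symm (fderiv ℝ c.toHomeo.symm (coordIncl k u₀))
    (c.toHomeo (c.param k u₀)) := by
    rw [c.apply_param hu₀]
    exact ((c.contDiffAt_symm hu₀.1).differentiableAt (by simp)).hasFDerivAt
  have h2 := ((c.contDiffAt (c.param_mem_source hu₀)).differentiableAt (by simp)).hasFDerivAt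
  have h3 := HasFDerivAt.comp (c.param k u₀) h1 h2
  have h4 : c.toHomeo.symm ∘ c.toHomeo =ᶠ[𝓝 (c.param k u₀)] id := by
    filter_upwards [c.toHomeo.open_source.mem_nhds (c.param_mem_source hu₀)] with y hy
    exact c.toHomeo.left_inv hy
  exact DFunLike.congr_fun ((h3.congr_of_eventuallyEq h4.symm).unique (hasFDerivAt_id _)) y

theorem isClosed_tangentDom (u₀ : EuclideanSpace ℝ (Fin k)) : IsClosed (tangentDom k u₀) := by
  have hincl : Continuous fun v : EuclideanSpace ℝ (Fin k) => coordIncl k v 0 :=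
    (EuclideanSpace.proj (𝕜 := ℝ) (0 : Fin 3)).continuous.comp (coordInclCLM k).continuous
  by_cases h : coordIncl k u₀ 0 = 0
  · simpa [tangentDom, h] using isClosed_le continuous_const hincl
  · simp [tangentDom, h]

theorem smul_sub_mem_tangentDom {u : EuclideanSpace ℝ (Fin k)} (hu : u ∈ c.dom k) {t : ℝ}
    (ht : 0 ≤ t) : t • (u - u₀) ∈ tangentDom k u₀ := by
  intro h
  have h1 : coordIncl k (t • (u - u₀)) = t • (coordIncl k u - coordIncl k u₀) := by
    simp only [← coordInclCLM_apply, map_smul, map_sub]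
  rw [h1]
  simp only [PiLp.smul_apply, PiLp.sub_apply, h, sub_zero, smul_eq_mul]
  exact mul_nonneg ht hu.2

/-- The tangent cone of the support of a smooth current is the tangent half-space. -/
theorem Represents.tangentConeOf_supp {T : Current k} (hT : c.Represents m T) (hm : m ≠ 0)
    (hk0 : 0 < k) (hk : k ≤ 3) (hu₀ : u₀ ∈ c.dom k)
    (hη : ∀ u ∈ c.dom k, ∃ η : E3 [⋀^Fin k]→L[ℝ] ℝ, η (c.tangent k u) ≠ 0) :
    tangentConeOf (supp T) (c.param k u₀)
      = {y | ∃ v ∈ tangentDom k u₀, y = c.param k u₀ + c.tangentMap k u₀ v} := by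
  set x := c.param k u₀ with hx
  have hmem : ∀ u ∈ c.dom k, c.param k u ∈ supp T := fun u hu =>
    (hη u hu).elim fun η h => hT.param_mem_supp hm hk0 hk hu h
  ext y
  constructor
  · intro hy
    obtain ⟨α, l, hl, t, d, hd, hds, hcd⟩ := exists_fun_of_mem_tangentConeAt hy
    have hcd' : Tendsto (fun n => (t n : ℝ) • d n) l (𝓝 (y - x)) := hcd
    have h2 := ((c.contDiffAt (c.param_mem_source hu₀)).differentiableAt (by simp)).hasFDerivAt
    -- The chart carries the difference quotients into the closed tangent half-space, so its
    -- derivative sends the limit vector there. The inverse derivative then returns it.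
    have h3 := (hasFDerivWithinAt_univ.2 h2).lim hd (by simp) hcd'
    have hxd : Tendsto (fun n => x + d n) l (𝓝 x) := by
      simpa using hd.const_add x
    have hsrc := hxd.eventually (c.toHomeo.open_source.mem_nhds (c.param_mem_source hu₀))
    have hemb : Topology.IsClosedEmbedding (coordInclCLM k) := by
      refine LinearMap.isClosedEmbedding_of_injective (LinearMap.ker_eq_bot'.2 fun v hv => ?_)
      rw [← norm_eq_zero, ← norm_coordIncl hk]
      exact norm_eq_zero.2 hv
    have hcl : IsClosed (coordInclCLM k '' tangentDom k u₀) :=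
      hemb.isClosedMap _ (isClosed_tangentDom u₀)
    have h4 := hcl.mem_of_tendsto h3 (by
      filter_upwards [hds, hsrc] with n hn hn'
      obtain ⟨u, hu, hux⟩ := hT.exists_param_eq hk hn hn'
      refine ⟨_, smul_sub_mem_tangentDom hu (t n).2, ?_⟩
      rw [← hx, ← hux, c.apply_param hu, hx, c.apply_param hu₀, map_smul, map_sub]
      rfl)
    obtain ⟨v, hv, hvy⟩ := h4
    refine ⟨v, hv, ?_⟩
    have h5 := fderiv_symm_fderiv hu₀ (y - x)
    rw [← hvy] at h5
    change c.tangentMap k u₀ v = y - x at h5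
    rw [h5]
    abel
  · rintro ⟨v, hv, rfl⟩
    change _ ∈ posTangentConeAt _ _
    rw [add_sub_cancel_left]
    refine mem_tangentConeAt_of_seq (𝓝[>] (0 : ℝ)) (fun ε => Real.toNNReal ε⁻¹)
      (fun ε => c.param k (u₀ + ε • v) - x) ?_ ?_ ?_
    · have := (c.hasFDerivAt_param hu₀).continuousAt.tendsto.comp (tendsto_add_smul u₀ v)
      have h6 := this.sub_const x
      simp only [← hx, sub_self, Function.comp_def] at h6
      exact h6
    · filter_upwards [c.eventually_mem_dom_iff hu₀ v] with ε hε
      rw [add_sub_cancel]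
      exact hmem _ (hε.2 hv)
    · refine (c.tendsto_slope_param hu₀ v).congr' ?_
      filter_upwards [self_mem_nhdsWithin] with ε hε
      rw [Set.mem_Ioi] at hε
      rw [NNReal.smul_def, Real.coe_toNNReal _ (by positivity)]

end SmoothChart

/-- The chart data of a smooth current. -/
theorem IsSmoothAt.exists_chart {k : ℕ} {T : Current k} {x : E3} (h : IsSmoothAt T x) :
    ∃ (c : SmoothChart) (u₀ : EuclideanSpace ℝ (Fin k)) (m : ℤ), u₀ ∈ c.dom k ∧
      c.param k u₀ = x ∧ m ≠ 0 ∧ c.Represents m T := by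
  obtain ⟨Φ, m, hx, h1, h2, ⟨u₀, hu₀, hu₀'⟩, hm, hT⟩ := h
  refine ⟨⟨Φ, h1, h2⟩, u₀, m, ⟨?_, hu₀'⟩, ?_, hm, hT⟩
  · rw [← hu₀]
    exact Φ.map_source hx
  · change Φ.symm (coordIncl k u₀) = x
    rw [← hu₀, Φ.left_inv hx]

/-! ### Comparison of a smooth surface with its smooth boundary curve -/

/-- The constant one-form dual to a vector. -/
def innerForm (l : E3) : E3 [⋀^Fin 1]→L[ℝ] ℝ :=
  ContinuousAlternatingMap.ofSubsingleton ℝ E3 ℝ (0 : Fin 1) (innerSL ℝ l)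

theorem innerForm_apply (l : E3) (p : Fin 1 → E3) : innerForm l p = inner ℝ l (p 0) := rfl

/-- The constant zero-form one. -/
def oneForm : E3 [⋀^Fin 0]→L[ℝ] ℝ := ContinuousAlternatingMap.constOfIsEmpty ℝ E3 (Fin 0) 1

theorem oneForm_apply (p : Fin 0 → E3) : oneForm p = 1 := rfl

theorem dForm_oneForm (ψ : E3 → ℝ) (z : E3) (p : Fin 1 → E3) :
    dForm ψ oneForm (z, p) = fderiv ℝ ψ z (p 0) := by
  simp [dForm, oneForm_apply]

theorem dForm_innerForm (ψ : E3 → ℝ) (l z : E3) (p : Fin 2 → E3) :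
    dForm ψ (innerForm l) (z, p)
      = fderiv ℝ ψ z (p 0) * inner ℝ l (p 1) - fderiv ℝ ψ z (p 1) * inner ℝ l (p 0) := by
  simp [dForm, innerForm_apply, Fin.removeNth, Fin.sum_univ_two]
  ring

namespace SmoothChart

variable {c : SmoothChart}

theorem coordIncl_one_zero (u : EuclideanSpace ℝ (Fin 1)) : coordIncl 1 u 0 = u 0 := by
  simp [coordIncl]

theorem coordIncl_two_zero (u : EuclideanSpace ℝ (Fin 2)) : coordIncl 2 u 0 = u 0 := by
  simp [coordIncl]

theorem tangentMap_linePoint (u₀ : EuclideanSpace ℝ (Fin 1)) (t : ℝ) :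
    c.tangentMap 1 u₀ (linePoint t) = t • c.tangent 1 u₀ 0 := by
  rw [linePoint, map_smul]
  rfl

theorem tangentMap_two (u₀ v : EuclideanSpace ℝ (Fin 2)) :
    c.tangentMap 2 u₀ v = v 0 • c.tangent 2 u₀ 0 + v 1 • c.tangent 2 u₀ 1 := by
  have : v = v 0 • EuclideanSpace.single 0 1 + v 1 • EuclideanSpace.single 1 1 := by
    ext j
    fin_cases j <;> simp
  conv_lhs => rw [this]
  rw [map_add, map_smul, map_smul]
  rfl

theorem tangent_one_ne_zero {u₀ : EuclideanSpace ℝ (Fin 1)} (hu₀ : u₀ ∈ c.dom 1) :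
    c.tangent 1 u₀ 0 ≠ 0 := by
  refine (map_ne_zero_iff (c.tangentMap 1 u₀) (c.tangentMap_injective (by simp) hu₀)).2 ?_
  simp

theorem cross_tangent_ne_zero {u₀ : EuclideanSpace ℝ (Fin 2)} (hu₀ : u₀ ∈ c.dom 2) :
    cross (c.tangent 2 u₀ 0) (c.tangent 2 u₀ 1) ≠ 0 := by
  refine cross_ne_zero fun s t h => ?_
  have h1 : c.tangentMap 2 u₀ (planePoint (s, t)) = 0 := by
    rw [planePoint, map_add, map_smul, map_smul]
    exact h
  have h2 := (map_eq_zero_iff _ (c.tangentMap_injective (by simp) hu₀)).1 h1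
  rw [planePoint_eq] at h2
  exact ⟨by simpa using congrArg (· 0) h2, by simpa using congrArg (· 1) h2⟩

/-- Index `0` is transversal to the edge and index `1` runs along it. Only the transversal
derivative at an edge point leaves a boundary term. -/
theorem setIntegral_dForm_innerForm {u₀ : EuclideanSpace ℝ (Fin 2)} (hu₀ : u₀ ∈ c.dom 2)
    {ψ : E3 → ℝ} {R : ℝ} (hψ : IsBump ψ R) (i : Fin 2) :
    ∫ v in tangentDom 2 u₀, fderiv ℝ ψ (c.tangentMap 2 u₀ v) (c.tangent 2 u₀ i) =
      if i = 0 ∧ u₀ 0 = 0 then -∫ t : ℝ, ψ (t • c.tangent 2 u₀ 1) else 0 := by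
  set G : EuclideanSpace ℝ (Fin 2) → ℝ := fun v => ψ (c.tangentMap 2 u₀ v) with hG
  have hGd : ContDiff ℝ 1 G :=
    (hψ.contDiff.of_le (by simp)).comp (c.tangentMap 2 u₀).contDiff
  have hGc : HasCompactSupport G :=
    hψ.hasCompactSupport.comp_isClosedEmbedding (isClosedEmbedding_tangentMap (by simp) hu₀)
  have h1 : ∀ v, fderiv ℝ ψ (c.tangentMap 2 u₀ v) (c.tangent 2 u₀ i)
      = fderiv ℝ G v (EuclideanSpace.single i 1) := by
    intro v
    have := HasFDerivAt.comp v ((hψ.contDiff.differentiable (by simp) _).hasFDerivAt)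
      (c.tangentMap 2 u₀).hasFDerivAt
    have h : fderiv ℝ G v = _ := HasFDerivAt.fderiv this
    rw [h]
    rfl
  have h2 : ∀ t : ℝ, ψ (t • c.tangent 2 u₀ 1) = G (t • EuclideanSpace.single 1 1) := by
    intro t
    simp only [hG, map_smul]
    rfl
  simp only [h1, h2]
  have h3 : tangentDom 2 u₀ = {v | v 0 ∈ {t : ℝ | u₀ 0 = 0 → 0 ≤ t}} := by
    ext v
    simp only [tangentDom, coordIncl_two_zero]
    rfl
  rw [h3]
  fin_cases i
  · by_cases h : u₀ 0 = 0
    · simpa [h] using setIntegral_fderiv_single_zero hGd hGc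
    · simpa [h] using integral_fderiv_single_zero hGd hGc
  · simpa using setIntegral_fderiv_single_one hGd hGc {t : ℝ | u₀ 0 = 0 → 0 ≤ t}

theorem integrable_fderiv_bump {u₀ : EuclideanSpace ℝ (Fin 2)} (hu₀ : u₀ ∈ c.dom 2)
    {ψ : E3 → ℝ} {R : ℝ} (hψ : IsBump ψ R) (p : E3) :
    Integrable fun v => fderiv ℝ ψ (c.tangentMap 2 u₀ v) p := by
  refine Continuous.integrable_of_hasCompactSupport ?_ ?_
  · exact ((hψ.contDiff.continuous_fderiv (by simp)).comp
      (c.tangentMap 2 u₀).continuous).clm_apply continuous_const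
  · exact (hψ.hasCompactSupport.fderiv_apply ℝ p).comp_isClosedEmbedding
      (isClosedEmbedding_tangentMap (by simp) hu₀)

/-- A point of a smooth curve which is not in the support of the boundary is an interior point. -/
theorem Represents.ne_zero_of_notMem_supp_boundary {M : Current 1} {m : ℤ}
    {u₀ : EuclideanSpace ℝ (Fin 1)} (hM : c.Represents m M) (hm : m ≠ 0) (hu₀ : u₀ ∈ c.dom 1)
    (hx : c.param 1 u₀ ∉ supp (boundary M)) : u₀ 0 ≠ 0 := by
  intro h0
  obtain ⟨s, hs, hso, hxs⟩ := (Distribution.notMem_dsupport_iff _).1 hx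
  obtain ⟨ψ, hψ, -, -, h1⟩ := exists_isBump zero_lt_one
  -- The boundary is tested on concentrated bump functions. At an endpoint of the curve the limit is
  -- `-m * ψ 0 = -m`, although the boundary vanishes near the point.
  have hlim := (tendsto_dForm (c := c) (k := 0) (by simp) hu₀ hψ oneForm).const_mul (m : ℝ)
  have hzero : (fun ε : ℝ => (m : ℝ) * ((ε ^ 0)⁻¹ * (ε⁻¹ * ∫ u in c.dom 1, dForm ψ oneForm
        (ε⁻¹ • (c.param 1 u - c.param 1 u₀), c.tangent 1 u)))) =ᶠ[𝓝[>] 0] fun _ => 0 := by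
    filter_upwards [hM.apply_extD_scaledForm hu₀ hψ oneForm, self_mem_nhdsWithin,
      eventually_closedBall_subset (hso.mem_nhds hxs) (1 + 1)] with ε h2 hε h3
    have h4 := hs _ ((tsupport_scaledForm_subset hψ.contDiff hψ.eq_zero oneForm _ hε).trans h3)
    have h5 : (m : ℝ) * (ε⁻¹ * ∫ u in c.dom 1, dForm ψ oneForm
        (ε⁻¹ • (c.param 1 u - c.param 1 u₀), c.tangent 1 u)) = 0 := (h2 hε).symm.trans h4
    rw [mul_left_comm, h5, mul_zero]
  have := tendsto_nhds_unique hlim (tendsto_const_nhds.congr' hzero.symm)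
  refine mul_ne_zero (by exact_mod_cast hm) ?_ this
  have h3 : tangentDom 1 u₀ = {v | v 0 ∈ Set.Ici (0 : ℝ)} := by
    ext v
    simp [tangentDom, coordIncl_one_zero, h0]
  change ∫ v in tangentDom 1 u₀, dForm ψ oneForm (c.tangentMap 1 u₀ v, c.tangent 1 u₀) ≠ 0
  simp only [dForm_oneForm]
  rw [h3, setIntegral_line]
  simp only [tangentMap_linePoint]
  have h4 := integral_Ici_fderiv_line (hψ.contDiff.of_le (by simp)) hψ.hasCompactSupport 0
    (tangent_one_ne_zero hu₀)
  simp only [zero_add] at h4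
  rw [h4, h1 0 (by simp)]
  norm_num

theorem integral_line_pos {ψ : E3 → ℝ} {R : ℝ} (hψ : IsBump ψ R) (h0 : ∀ z, 0 ≤ ψ z)
    (h1 : ψ 0 = 1) {e : E3} (he : e ≠ 0) : 0 < ∫ t : ℝ, ψ (t • e) := by
  have hcont : Continuous fun t : ℝ => ψ (t • e) := hψ.contDiff.continuous.comp (by fun_prop)
  refine hcont.integral_pos_of_hasCompactSupport_nonneg_nonzero
    (hψ.hasCompactSupport.comp_isClosedEmbedding (isClosedEmbedding_smul_left he))
    (fun t => h0 _) (x := 0) ?_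
  simp [h1]

/-- The infinitesimal form of the relation `∂S = M`. -/
theorem Represents.boundary_identity {c' : SmoothChart} {S : Current 2} {M : Current 1} {m m' : ℤ}
    {u₀ : EuclideanSpace ℝ (Fin 2)} {u₁ : EuclideanSpace ℝ (Fin 1)}
    (hS : c.Represents m S) (hM : c'.Represents m' M) (hu₀ : u₀ ∈ c.dom 2) (hu₁ : u₁ ∈ c'.dom 1)
    (hx : c.param 2 u₀ = c'.param 1 u₁) (hint : u₁ 0 ≠ 0) {s : Set E3}
    (hs : s ∈ 𝓝 (c'.param 1 u₁))
    (hbd : ∀ φ : Form 1, tsupport φ ⊆ s → boundary S φ = M φ)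
    {ψ : E3 → ℝ} {R : ℝ} (hψ : IsBump ψ R) (l : E3) :
    (m : ℝ) * ((if u₀ 0 = 0 then -∫ t : ℝ, ψ (t • c.tangent 2 u₀ 1) else 0)
        * inner ℝ l (c.tangent 2 u₀ 1))
      = m' * ((∫ t : ℝ, ψ (t • c'.tangent 1 u₁ 0)) * inner ℝ l (c'.tangent 1 u₁ 0)) := by
  -- Both sides are of order `ε`: the surface contributes `ε²` and the exterior derivative `ε⁻¹`,
  -- against `ε` for the curve.
  have hlim := (tendsto_dForm (c := c) (k := 1) (by simp) hu₀ hψ (innerForm l)).const_mul (m : ℝ)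
  have hlim' := (tendsto_scaledForm (c := c') (k := 1) (by simp) hu₁ hψ
    (innerForm l)).const_mul (m' : ℝ)
  have h1 : ∫ v in tangentDom 2 u₀, dForm ψ (innerForm l) (c.tangentMap 2 u₀ v, c.tangent 2 u₀)
      = (if u₀ 0 = 0 then -∫ t : ℝ, ψ (t • c.tangent 2 u₀ 1) else 0)
        * inner ℝ l (c.tangent 2 u₀ 1) := by
    simp only [dForm_innerForm]
    rw [integral_sub ((integrable_fderiv_bump hu₀ hψ _).mul_const _).integrableOn
      ((integrable_fderiv_bump hu₀ hψ _).mul_const _).integrableOn, integral_mul_const,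
      integral_mul_const, setIntegral_dForm_innerForm hu₀ hψ, setIntegral_dForm_innerForm hu₀ hψ]
    simp
  have h2 : (∫ v in tangentDom 1 u₁, ψ (c'.tangentMap 1 u₁ v)) * innerForm l (c'.tangent 1 u₁)
      = (∫ t : ℝ, ψ (t • c'.tangent 1 u₁ 0)) * inner ℝ l (c'.tangent 1 u₁ 0) := by
    have h3 : tangentDom 1 u₁ = {v | v 0 ∈ (Set.univ : Set ℝ)} := by
      ext v
      simp [tangentDom, coordIncl_one_zero, hint]
    rw [h3, setIntegral_line, innerForm_apply]
    simp only [tangentMap_linePoint, Measure.restrict_univ]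
  rw [← h1, ← h2]
  refine tendsto_nhds_unique hlim (hlim'.congr' ?_)
  filter_upwards [hS.apply_extD_scaledForm hu₀ hψ (innerForm l),
    hM.apply_scaledForm hu₁ hψ (innerForm l), self_mem_nhdsWithin,
    eventually_closedBall_subset hs R] with ε h3 h4 hε h5
  have h6 := hbd _ ((tsupport_scaledForm_subset hψ.contDiff hψ.eq_zero (innerForm l) _ hε).trans h5)
  have h7 := h3 hε
  simp only [Nat.reduceAdd, hx] at h7 ⊢
  rw [h6, h4 hε] at h7
  rw [mul_left_comm, h7, mul_left_comm]

/-- A smooth surface whose boundary is near `x` a smooth curve has `x` as a boundary point, the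
curve is tangent to the edge of the surface and the multiplicities agree up to sign. -/
theorem Represents.boundary_alignment {c' : SmoothChart} {S : Current 2} {M : Current 1} {m m' : ℤ}
    {u₀ : EuclideanSpace ℝ (Fin 2)} {u₁ : EuclideanSpace ℝ (Fin 1)}
    (hS : c.Represents m S) (hM : c'.Represents m' M) (hm' : m' ≠ 0) (hu₀ : u₀ ∈ c.dom 2)
    (hu₁ : u₁ ∈ c'.dom 1) (hx : c.param 2 u₀ = c'.param 1 u₁) (hint : u₁ 0 ≠ 0) {s : Set E3}
    (hs : s ∈ 𝓝 (c'.param 1 u₁))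
    (hbd : ∀ φ : Form 1, tsupport φ ⊆ s → boundary S φ = M φ) :
    u₀ 0 = 0 ∧ |(m : ℝ)| = |(m' : ℝ)| ∧
      ∃ κ : ℝ, κ ≠ 0 ∧ c'.tangent 1 u₁ 0 = κ • c.tangent 2 u₀ 1 := by
  obtain ⟨ψ, hψ, h0, -, h1⟩ := exists_isBump zero_lt_one
  have h1 := h1 0 (by simp)
  have key := hS.boundary_identity hM hu₀ hu₁ hx hint hs hbd hψ
  set a := c'.tangent 1 u₁ 0 with ha
  set b := c.tangent 2 u₀ 1 with hb
  have ha0 : a ≠ 0 := tangent_one_ne_zero hu₁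
  have hb0 : b ≠ 0 := by
    refine (map_ne_zero_iff (c.tangentMap 2 u₀) (c.tangentMap_injective (by simp) hu₀)).2 ?_
    simp
  have hm'' : (m' : ℝ) ≠ 0 := by exact_mod_cast hm'
  have hpa := integral_line_pos hψ h0 h1 ha0
  have hpb := integral_line_pos hψ h0 h1 hb0
  have haa : (inner ℝ a a : ℝ) ≠ 0 := inner_self_ne_zero.2 ha0
  have hbb : (inner ℝ b b : ℝ) ≠ 0 := inner_self_ne_zero.2 hb0
  -- At an interior point of the surface the left side vanishes for every `l`, while for `l = a` the
  -- right side does not.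
  have hu : u₀ 0 = 0 := by
    by_contra hne
    have := key a
    rw [if_neg hne, zero_mul, mul_zero] at this
    exact mul_ne_zero hm'' (mul_ne_zero hpa.ne' haa) this.symm
  simp only [hu, if_true] at key
  obtain ⟨κ, hκ⟩ : ∃ κ : ℝ, a = κ • b := by
    refine ⟨inner ℝ a b / inner ℝ b b, ?_⟩
    -- Testing with the component of `a` orthogonal to `b` makes the left side zero, so this
    -- component is orthogonal to `a` as well and must vanish.
    set l := a - (inner ℝ a b / inner ℝ b b : ℝ) • b with hl
    have hlb : (inner ℝ l b : ℝ) = 0 := by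
      rw [hl, inner_sub_left, real_inner_smul_left, div_mul_cancel₀ _ hbb, sub_self]
    have h2 := key l
    rw [hlb, mul_zero, mul_zero] at h2
    have h3 : (inner ℝ l a : ℝ) = 0 := by
      by_contra hne
      exact mul_ne_zero hm'' (mul_ne_zero hpa.ne' hne) h2.symm
    have h4 : (inner ℝ l l : ℝ) = 0 := by
      have : (inner ℝ l l : ℝ) = inner ℝ l (a - (inner ℝ a b / inner ℝ b b : ℝ) • b) := by
        rw [← hl]
      rw [this, inner_sub_right, h3, real_inner_smul_right, hlb]
      simp
    exact sub_eq_zero.1 (inner_self_eq_zero.1 h4)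
  have hκ0 : κ ≠ 0 := by
    rintro rfl
    exact ha0 (by simpa using hκ)
  refine ⟨hu, ?_, κ, hκ0, hκ⟩
  -- With `a = κ • b`, rescaling the line integral gives the factor `|κ⁻¹|` and the inner product
  -- gives `κ`. Their product is a sign, so `m` and `m'` agree up to sign.
  have h2 := key b
  have h3 : ∫ t : ℝ, ψ (t • a) = |κ⁻¹| * ∫ t : ℝ, ψ (t • b) := by
    have := Measure.integral_comp_mul_right (fun t : ℝ => ψ (t • b)) κ
    simpa only [mul_smul, ← hκ, smul_eq_mul] using this
  have h4 : (inner ℝ b a : ℝ) = κ * inner ℝ b b := by rw [hκ, real_inner_smul_right]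
  rw [h3, h4] at h2
  have h5 : (-(m : ℝ)) = m' * (|κ⁻¹| * κ) := by
    have hne := mul_ne_zero hpb.ne' hbb
    apply mul_right_cancel₀ hne
    linarith
  have h6 : abs (|κ⁻¹| * κ) = 1 := by
    rw [abs_mul, abs_abs, abs_inv, inv_mul_cancel₀ (abs_ne_zero.2 hκ0)]
  rw [← abs_neg (m : ℝ), h5, abs_mul, h6, mul_one]

end SmoothChart

/-! ### The first variation of mass under a concentrated deformation -/

/-- The product of a smooth function and a form. -/
def mulForm {k : ℕ} {g : E3 → ℝ} (hg : ContDiff ℝ ∞ g) (φ : Form k) : Form k where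
  toFun y := g y • φ y
  contDiff' := hg.smul φ.contDiff
  hasCompactSupport' := HasCompactSupport.intro φ.hasCompactSupport.isCompact fun y hy => by
    rw [image_eq_zero_of_notMem_tsupport hy, smul_zero]
  tsupport_subset' := fun _ _ => trivial

theorem mulForm_apply {k : ℕ} {g : E3 → ℝ} (hg : ContDiff ℝ ∞ g) (φ : Form k) (y : E3) :
    mulForm hg φ y = g y • φ y := rfl

section Bump

variable {ψ : E3 → ℝ} {R : ℝ} (hψ : IsBump ψ R) (x w : E3) (τ : ℝ) {ε : ℝ} (hε : 0 < ε)

include hψ hε in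
theorem tsupport_displacement_subset :
    tsupport (fun y => y + (ε * τ * ψ (ε⁻¹ • (y - x))) • w - y)
      ⊆ Metric.closedBall x (ε * R) := by
  simp only [add_sub_cancel_left]
  exact tsupport_scaled_subset (g := fun z => (ε * τ * ψ z) • w)
    (fun z hz => by simp [hψ.eq_zero z hz]) x hε

/-- The deformation which moves points near `x` at scale `ε` in the direction of `w`. -/
def bumpDeformation : Deformation where
  -- The amplitude is proportional to the scale `ε`, so the derivative, read in rescaled
  -- coordinates, depends on `τ` but not on `ε`.
  toFun y := y + (ε * τ * ψ (ε⁻¹ • (y - x))) • w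
  contDiff := contDiff_id.add
    ((contDiff_const.mul (contDiff_scaled hψ.contDiff x ε)).smul contDiff_const)
  hasCompactSupport := (isCompact_closedBall x (ε * R)).of_isClosed_subset (isClosed_tsupport _)
    (tsupport_displacement_subset hψ x w τ hε)

theorem bumpDeformation_apply (y : E3) :
    (bumpDeformation hψ x w τ hε).toFun y = y + (ε * τ * ψ (ε⁻¹ • (y - x))) • w := rfl

theorem tsupport_bumpDeformation_subset :
    tsupport (fun y => (bumpDeformation hψ x w τ hε).toFun y - y) ⊆ Metric.closedBall x (ε * R) :=
  tsupport_displacement_subset hψ x w τ hε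

theorem fderiv_bumpDeformation (y p : E3) : fderiv ℝ (bumpDeformation hψ x w τ hε).toFun y p
    = p + (τ * fderiv ℝ ψ (ε⁻¹ • (y - x)) p) • w := by
  have h1 : DifferentiableAt ℝ (fun y => ψ (ε⁻¹ • (y - x))) y :=
    (contDiff_scaled hψ.contDiff x ε).differentiable (by simp) y
  have h2 := (hasFDerivAt_id y).add ((h1.hasFDerivAt.const_mul (ε * τ)).smul_const w)
  have h3 : fderiv ℝ (bumpDeformation hψ x w τ hε).toFun y = _ := h2.fderiv
  rw [h3]
  have h4 := fderiv_scaled (hψ.contDiff.differentiable (by simp)) x ε y p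
  simp only [_root_.add_apply, ContinuousLinearMap.smulRight_apply, _root_.smul_apply, h4,
    smul_eq_mul]
  have h5 : ε * τ * (ε⁻¹ * fderiv ℝ ψ (ε⁻¹ • (y - x)) p)
      = τ * fderiv ℝ ψ (ε⁻¹ • (y - x)) p := by
    field_simp
  rw [h5]
  rfl

end Bump

/-- The area element of a surface moved by the deformation `z ↦ z + τ ψ(z) w`. -/
def movedArea (ψ : E3 → ℝ) (w : E3) (τ : ℝ) (q : E3 × (Fin 2 → E3)) : ℝ :=
  ‖cross (q.2 0 + (τ * fderiv ℝ ψ q.1 (q.2 0)) • w) (q.2 1 + (τ * fderiv ℝ ψ q.1 (q.2 1)) • w)‖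

theorem continuous_movedArea {ψ : E3 → ℝ} {R : ℝ} (hψ : IsBump ψ R) (w : E3) (τ : ℝ) :
    Continuous (movedArea ψ w τ) := by
  have h : Continuous (fderiv ℝ ψ) := hψ.contDiff.continuous_fderiv (by simp)
  have h1 : ∀ i : Fin 2, Continuous fun q : E3 × (Fin 2 → E3) =>
      q.2 i + (τ * fderiv ℝ ψ q.1 (q.2 i)) • w := by
    intro i
    have h2 : Continuous fun q : E3 × (Fin 2 → E3) => q.2 i :=
      (continuous_apply i).comp continuous_snd
    exact h2.add ((continuous_const.mul ((h.comp continuous_fst).clm_apply h2)).smul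
      continuous_const)
  exact (continuous_cross.comp ((h1 0).prodMk (h1 1))).norm

/-- A cutoff equal to one wherever points move splits the pulled-back form. The inner part is
bounded by the moved area. The outer part is completed to a form of norm at most one by the constant
form with normal `n`, so the mass of `S` bounds it after subtracting the flux through `n`. No
localization of mass as a measure is needed. -/
theorem SmoothChart.Represents.push_apply_le {c : SmoothChart} {S : Current 2} {m : ℤ}
    {u₀ : EuclideanSpace ℝ (Fin 2)} (hS : c.Represents m S) (hfin : mass S ≠ ⊤)
    (hu₀ : u₀ ∈ c.dom 2) {ψ χ : E3 → ℝ} {R R' : ℝ} (hψ : IsBump ψ R) (hχ : IsBump χ R')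
    (hχ0 : ∀ z, 0 ≤ χ z) (hχ1 : ∀ z, χ z ≤ 1) (hχR : ∀ z, ‖z‖ ≤ R → χ z = 1)
    (w : E3) (τ : ℝ) {n : E3} (hn : ‖n‖ ≤ 1) : ∀ᶠ ε in 𝓝[>] (0 : ℝ), ∀ hε : 0 < ε,
    ∀ φ : Form 2, (∀ y, ‖φ y‖ ≤ 1) →
    (bumpDeformation hψ (c.param 2 u₀) w τ hε).push S hfin φ ≤
      (mass S).toReal + |(m : ℝ)| *
        ((∫ u in c.dom 2, χ (ε⁻¹ • (c.param 2 u - c.param 2 u₀)) *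
            movedArea ψ w τ (ε⁻¹ • (c.param 2 u - c.param 2 u₀), c.tangent 2 u)) -
          ∫ u in c.dom 2, χ (ε⁻¹ • (c.param 2 u - c.param 2 u₀)) *
            crossForm n (c.tangent 2 u)) := by
  -- The sign `σ` orients the test form so that it sees `|m|`.
  obtain ⟨σ, hσ1, hσm⟩ : ∃ σ : ℝ, ‖σ‖ ≤ 1 ∧ m * σ = |(m : ℝ)| := by
    rcases abs_choice (m : ℝ) with h | h
    · exact ⟨1, by simp, by rw [h, mul_one]⟩
    · exact ⟨-1, by simp, by rw [h, mul_neg_one]⟩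
  have hint := c.eventually_integrableOn_blowup (by simp) hu₀
    (f := fun q => χ q.1 * movedArea ψ w τ q) (R := R' + 1)
    ((hχ.contDiff.continuous.comp continuous_fst).mul (continuous_movedArea hψ w τ))
    (fun z p hz => by simp [hχ.eq_zero z (by linarith)])
  filter_upwards [hS.apply_scaledForm hu₀ hχ (σ • crossForm n), hint,
    eventually_closedBall_subset (c.toHomeo.open_source.mem_nhds (c.param_mem_source hu₀)) R']
    with ε h1 h2 h3 hε φ hφ
  set x := c.param 2 u₀ with hx
  set h := bumpDeformation hψ x w τ hε with hh
  have hg : ContDiff ℝ ∞ fun y => χ (ε⁻¹ • (y - x)) := contDiff_scaled hχ.contDiff x ε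
  set ω₀ := scaledForm hχ.contDiff hχ.eq_zero (σ • crossForm n) x hε with hω₀
  have hdec : h.pullback 2 φ = mulForm hg (h.pullback 2 φ) + (φ - mulForm hg φ) := by
    ext1 y
    rw [_root_.add_apply, _root_.sub_apply, mulForm_apply, mulForm_apply]
    by_cases hy : y ∈ tsupport fun y => h.toFun y - y
    · have hy' := tsupport_bumpDeformation_subset hψ x w τ hε hy
      have : χ (ε⁻¹ • (y - x)) = 1 := by
        refine hχR _ ?_
        rw [norm_smul, norm_inv, Real.norm_of_nonneg hε.le, inv_mul_le_iff₀ hε]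
        exact mem_closedBall_iff_norm.1 hy'
      rw [this, one_smul, one_smul, sub_self, add_zero]
    · rw [h.pullback_eq_of_notMem φ hy]
      abel
  -- Pointwise this is a convex combination of two covectors of norm at most one.
  have htest : S (φ - mulForm hg φ + ω₀) ≤ (mass S).toReal * 1 := by
    refine apply_le_mass_mul hfin zero_le_one fun y => ?_
    rw [_root_.add_apply, _root_.sub_apply, mulForm_apply, hω₀, scaledForm_apply]
    set t := χ (ε⁻¹ • (y - x))
    have ht0 : 0 ≤ t := hχ0 _
    have ht1 : 0 ≤ 1 - t := sub_nonneg.2 (hχ1 _)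
    have h4 : φ y - t • φ y = (1 - t) • φ y := by module
    have h5 : ‖σ • crossForm n‖ ≤ 1 := by
      rw [norm_smul]
      exact mul_le_one₀ hσ1 (norm_nonneg _) ((norm_crossForm_le n).trans hn)
    calc ‖φ y - t • φ y + t • σ • crossForm n‖ ≤ ‖(1 - t) • φ y‖ + ‖t • σ • crossForm n‖ := by
          rw [h4]; exact norm_add_le _ _
      _ ≤ (1 - t) * 1 + t * 1 := by
          rw [norm_smul (1 - t), norm_smul t, Real.norm_of_nonneg ht0, Real.norm_of_nonneg ht1]
          gcongr
          exact hφ y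
      _ = 1 := by ring
  have hω : S ω₀ = |(m : ℝ)| *
      ∫ u in c.dom 2, χ (ε⁻¹ • (c.param 2 u - x)) * crossForm n (c.tangent 2 u) := by
    rw [hω₀, h1 hε, ← hσm, mul_assoc, ← integral_const_mul σ]
    congr 2
    funext u
    rw [ContinuousAlternatingMap.smul_apply, smul_eq_mul]
    ring
  have hmain : S (mulForm hg (h.pullback 2 φ)) ≤ |(m : ℝ)| *
      ∫ u in c.dom 2, χ (ε⁻¹ • (c.param 2 u - x)) *
        movedArea ψ w τ (ε⁻¹ • (c.param 2 u - x), c.tangent 2 u) := by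
    rw [hS]
    · refine (le_abs_self _).trans ?_
      rw [abs_mul]
      refine mul_le_mul_of_nonneg_left ?_ (abs_nonneg _)
      rw [← Real.norm_eq_abs]
      refine norm_integral_le_of_norm_le h2 (Eventually.of_forall fun u => ?_)
      rw [mulForm_apply, ContinuousAlternatingMap.smul_apply, smul_eq_mul, norm_mul, Real.norm_of_nonneg (hχ0 _)]
      refine mul_le_mul_of_nonneg_left ?_ (hχ0 _)
      rw [h.pullback_apply, ContinuousAlternatingMap.compContinuousLinearMap_apply]
      refine (apply_two_le _ _).trans ?_
      refine (mul_le_of_le_one_left (norm_nonneg _) (hφ _)).trans_eq ?_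
      simp only [Function.comp_apply, movedArea, hh, fderiv_bumpDeformation]
    · refine Set.Subset.trans ?_ ((tsupport_scaled_subset (g := χ) hχ.eq_zero x hε).trans h3)
      exact tsupport_smul_subset_left _ _
  rw [h.push_apply, hdec, map_add]
  rw [map_add, hω] at htest
  linarith

/-- All points move in the single direction `w`, and `cross w w = 0` removes the quadratic term: the
area element is the norm of an affine function of `τ`. -/
theorem movedArea_eq (ψ : E3 → ℝ) (w : E3) (τ : ℝ) (z : E3) (p : Fin 2 → E3) :
    movedArea ψ w τ (z, p) = ‖cross (p 0) (p 1) + τ • (fderiv ℝ ψ z (p 0) • cross w (p 1)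
      + fderiv ℝ ψ z (p 1) • cross (p 0) w)‖ := by
  simp only [movedArea, cross_add_left, cross_add_right, cross_smul_left, cross_smul_right,
    cross_self]
  congr 1
  module

section FlatVariation

variable {c : SmoothChart} {u₀ : EuclideanSpace ℝ (Fin 2)}

theorem integrable_bump_mul (hu₀ : u₀ ∈ c.dom 2) {χ : E3 → ℝ} {R : ℝ} (hχ : IsBump χ R)
    {F : EuclideanSpace ℝ (Fin 2) → ℝ} (hF : Continuous F) :
    Integrable fun v => χ (c.tangentMap 2 u₀ v) * F v := by
  refine Continuous.integrable_of_hasCompactSupport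
    ((hχ.contDiff.continuous.comp (c.tangentMap 2 u₀).continuous).mul hF) ?_
  exact (hχ.hasCompactSupport.comp_isClosedEmbedding
    (SmoothChart.isClosedEmbedding_tangentMap (by simp) hu₀)).mul_right

/-- The area of a half-plane under a deformation, up to second order. -/
theorem exists_movedArea_bound (hu₀ : u₀ ∈ c.dom 2) (hu : u₀ 0 = 0) {ψ χ : E3 → ℝ} {R R' : ℝ}
    (hψ : IsBump ψ R) (hχ : IsBump χ R') (hχ0 : ∀ z, 0 ≤ χ z) (hχR : ∀ z, ‖z‖ ≤ R → χ z = 1)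
    (w : E3) : ∃ C : ℝ, ∀ τ : ℝ,
      (∫ v in SmoothChart.tangentDom 2 u₀, χ (c.tangentMap 2 u₀ v) *
          movedArea ψ w τ (c.tangentMap 2 u₀ v, c.tangent 2 u₀)) -
        ∫ v in SmoothChart.tangentDom 2 u₀, χ (c.tangentMap 2 u₀ v) *
          ‖cross (c.tangent 2 u₀ 0) (c.tangent 2 u₀ 1)‖
      ≤ -τ * (inner ℝ (cross (c.tangent 2 u₀ 0) (c.tangent 2 u₀ 1)) (cross w (c.tangent 2 u₀ 1))
          / ‖cross (c.tangent 2 u₀ 0) (c.tangent 2 u₀ 1)‖ * ∫ t : ℝ, ψ (t • c.tangent 2 u₀ 1))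
        + τ ^ 2 * C := by
  have hξ := SmoothChart.cross_tangent_ne_zero hu₀
  have ha := SmoothChart.setIntegral_dForm_innerForm hu₀ hψ 0
  have hb := SmoothChart.setIntegral_dForm_innerForm hu₀ hψ 1
  have hia := SmoothChart.integrable_fderiv_bump hu₀ hψ (c.tangent 2 u₀ 0)
  have hib := SmoothChart.integrable_fderiv_bump hu₀ hψ (c.tangent 2 u₀ 1)
  rw [if_pos ⟨rfl, hu⟩] at ha
  rw [if_neg (by simp)] at hb
  have hD : ∀ p, Continuous fun v => fderiv ℝ ψ (c.tangentMap 2 u₀ v) p := fun p =>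
    ((hψ.contDiff.continuous_fderiv (by simp)).comp (c.tangentMap 2 u₀).continuous).clm_apply
      continuous_const
  -- The cutoff is one wherever the derivative of `ψ` is nonzero, so it drops out of the linear term
  -- and Stokes' theorem applies to `ψ` alone.
  have hχD : ∀ z p, χ z * fderiv ℝ ψ z p = fderiv ℝ ψ z p := by
    intro z p
    rcases le_or_gt ‖z‖ R with hz | hz
    · rw [hχR z hz, one_mul]
    · have : ψ =ᶠ[𝓝 z] fun _ => 0 := by
        filter_upwards [continuous_norm.continuousAt.eventually_const_lt hz] with y hy
        exact hψ.eq_zero y hy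
      simp [this.fderiv_eq]
  set a := c.tangent 2 u₀ 0
  set b := c.tangent 2 u₀ 1
  set ξ := cross a b
  set L := c.tangentMap 2 u₀
  set α : EuclideanSpace ℝ (Fin 2) → ℝ := fun v => fderiv ℝ ψ (L v) a
  set β : EuclideanSpace ℝ (Fin 2) → ℝ := fun v => fderiv ℝ ψ (L v) b
  set η : EuclideanSpace ℝ (Fin 2) → E3 := fun v => α v • cross w b + β v • cross a w
  have hη : Continuous η :=
    ((hD a).smul continuous_const).add ((hD b).smul continuous_const)
  set p : ℝ := inner ℝ ξ (cross w b) / ‖ξ‖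
  set q : ℝ := inner ℝ ξ (cross a w) / ‖ξ‖
  refine ⟨∫ v in SmoothChart.tangentDom 2 u₀, χ (L v) * (‖η v‖ ^ 2 / (2 * ‖ξ‖)), fun τ => ?_⟩
  have hi1 : Integrable fun v => χ (L v) * movedArea ψ w τ (L v, c.tangent 2 u₀) :=
    integrable_bump_mul hu₀ hχ ((continuous_movedArea hψ w τ).comp
      (L.continuous.prodMk continuous_const))
  have hi2 : Integrable fun v => χ (L v) * ‖ξ‖ := integrable_bump_mul hu₀ hχ continuous_const
  have hi3 : Integrable fun v => χ (L v) * (‖η v‖ ^ 2 / (2 * ‖ξ‖)) :=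
    integrable_bump_mul hu₀ hχ ((hη.norm.pow 2).div_const _)
  have hi4 : Integrable fun v => τ * (α v * p + β v * q) :=
    ((hia.mul_const p).add (hib.mul_const q)).const_mul τ
  have hpt : ∀ v, χ (L v) * movedArea ψ w τ (L v, c.tangent 2 u₀) - χ (L v) * ‖ξ‖
      ≤ τ * (α v * p + β v * q) + τ ^ 2 * (χ (L v) * (‖η v‖ ^ 2 / (2 * ‖ξ‖))) := by
    intro v
    have h1 : movedArea ψ w τ (L v, c.tangent 2 u₀) = ‖ξ + τ • η v‖ := movedArea_eq _ _ _ _ _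
    have h2 := mul_le_mul_of_nonneg_left (norm_add_smul_le (η := η v) hξ τ) (hχ0 (L v))
    have h3 : inner ℝ ξ (η v) / ‖ξ‖ = α v * p + β v * q := by
      simp only [η, inner_add_right, inner_smul_right, p, q]
      ring
    have h4 : χ (L v) * (α v * p + β v * q) = α v * p + β v * q := by
      calc χ (L v) * (α v * p + β v * q) = (χ (L v) * α v) * p + (χ (L v) * β v) * q := by ring
        _ = _ := by rw [hχD (L v) a, hχD (L v) b]
    rw [h1]
    rw [h3] at h2
    calc χ (L v) * ‖ξ + τ • η v‖ - χ (L v) * ‖ξ‖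
        ≤ τ * (χ (L v) * (α v * p + β v * q))
          + τ ^ 2 * (χ (L v) * (‖η v‖ ^ 2 / (2 * ‖ξ‖))) := by linarith
      _ = _ := by rw [h4]
  rw [← integral_sub hi1.integrableOn hi2.integrableOn]
  refine (integral_mono (hi1.sub hi2).integrableOn
    (hi4.add (hi3.const_mul (τ ^ 2))).integrableOn hpt).trans_eq ?_
  simp only [Pi.add_apply]
  rw [integral_add hi4.integrableOn (hi3.const_mul (τ ^ 2)).integrableOn, integral_const_mul,
    integral_const_mul, integral_add (hia.mul_const p).integrableOn (hib.mul_const q).integrableOn,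
    integral_mul_const, integral_mul_const, ha, hb]
  ring

end FlatVariation

/-! ### Half-planes -/

/-- Gram–Schmidt: `v` is the normalized component of `a` orthogonal to the edge, and `0 < β` puts it
on the side of the surface. -/
theorem exists_page {a b e : E3} {κ : ℝ} (he : ‖e‖ = 1) (hb : b = κ • e) (hab : cross a b ≠ 0) :
    ∃ (v : E3) (α β : ℝ), ‖v‖ = 1 ∧ inner ℝ e v = (0 : ℝ) ∧ 0 < β ∧ a = α • e + β • v := by
  set d := a - (inner ℝ e a : ℝ) • e with hd
  have hd0 : d ≠ 0 := by
    intro h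
    apply hab
    rw [sub_eq_zero.1 h, hb, cross_smul_left, cross_smul_right, cross_self, smul_zero, smul_zero]
  have hn : ‖d‖ ≠ 0 := norm_ne_zero_iff.2 hd0
  refine ⟨‖d‖⁻¹ • d, inner ℝ e a, ‖d‖, ?_, ?_, norm_pos_iff.2 hd0, ?_⟩
  · rw [norm_smul, norm_inv, norm_norm, inv_mul_cancel₀ hn]
  · rw [inner_smul_right, hd, inner_sub_right, inner_smul_right, real_inner_self_eq_norm_sq, he]
    ring
  · rw [smul_smul, mul_inv_cancel₀ hn, one_smul, hd]
    abel

theorem halfPlane_eq {a b e v x : E3} {κ α β : ℝ} (hκ : κ ≠ 0) (hb : b = κ • e)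
    (hβ : 0 < β) (ha : a = α • e + β • v) :
    halfPlane x e v = {y | ∃ s t : ℝ, 0 ≤ s ∧ y = x + (s • a + t • b)} := by
  ext y
  constructor
  · rintro ⟨s, t, ht, rfl⟩
    refine ⟨t / β, (s - t / β * α) / κ, by positivity, ?_⟩
    rw [ha, hb, smul_add, smul_smul, smul_smul, smul_smul, div_mul_cancel₀ _ hβ.ne',
      div_mul_cancel₀ _ hκ]
    module
  · rintro ⟨s, t, hs, rfl⟩
    refine ⟨s * α + t * κ, s * β, by positivity, ?_⟩
    rw [ha, hb]
    module

/-- The first variation does not depend on the parametrization: the shear `α` drops out by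
antisymmetry, `β` cancels in the quotient, and the remaining `|κ|` cancels against the rescaled edge
integral. -/
theorem conormal_coefficient {a b e v : E3} {κ α β : ℝ} (he : ‖e‖ = 1) (hv : ‖v‖ = 1)
    (hev : inner ℝ e v = (0 : ℝ)) (hκ : κ ≠ 0) (hb : b = κ • e) (hβ : 0 < β)
    (ha : a = α • e + β • v) (w : E3) (ψ : E3 → ℝ) :
    inner ℝ (cross a b) (cross w b) / ‖cross a b‖ * ∫ t : ℝ, ψ (t • b)
      = inner ℝ v w * ∫ t : ℝ, ψ (t • e) := by
  have h1 : cross a b = (β * κ) • cross v e := by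
    rw [ha, hb, cross_add_left, cross_smul_left, cross_smul_left, cross_smul_right,
      cross_smul_right, cross_self]
    module
  have h2 : ‖cross v e‖ = 1 := by
    have h3 := norm_cross_sq v e
    rw [hv, he, real_inner_comm, hev] at h3
    have h4 : ‖cross v e‖ ^ 2 = 1 := by rw [h3]; norm_num
    exact (pow_eq_one_iff_of_nonneg (norm_nonneg _) two_ne_zero).1 h4
  have h3 : ‖cross a b‖ = β * |κ| := by
    rw [h1, norm_smul, h2, Real.norm_eq_abs, abs_mul, abs_of_pos hβ, mul_one]
  have h4 : (inner ℝ (cross a b) (cross w b) : ℝ) = β * κ ^ 2 * inner ℝ v w := by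
    rw [h1, hb, cross_smul_right, real_inner_smul_left, real_inner_smul_right, inner_cross_cross,
      real_inner_self_eq_norm_sq, he, real_inner_comm e v, hev]
    ring
  have h5 : ∫ t : ℝ, ψ (t • b) = |κ⁻¹| * ∫ t : ℝ, ψ (t • e) := by
    have := Measure.integral_comp_mul_right (fun t : ℝ => ψ (t • e)) κ
    simpa only [mul_smul, ← hb, smul_eq_mul] using this
  have h6 : |κ| ≠ 0 := abs_ne_zero.2 hκ
  rw [h3, h4, h5, abs_inv, ← sq_abs κ]
  field_simp

/-! ### Local replacement -/

/-- The push-forwards of `S` under deformations concentrated at scale `ε` around `x` in the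
direction of `w` have at most the mass of `S` plus `μ δ(ε)`, where `δ(ε) / ε²` converges to a number
which is for small `τ` dominated by the first variation `-τ ⟨v, w⟩ K`. -/
def HasConormal (S : Current 2) (hfin : mass S ≠ ⊤) (x : E3) (μ : ℝ) (e v : E3) : Prop :=
  ∀ (ψ : E3 → ℝ) (R : ℝ) (hψ : IsBump ψ R) (w : E3), ∃ C : ℝ, ∀ τ : ℝ, ∃ (δ : ℝ → ℝ) (d : ℝ),
    d ≤ -τ * (inner ℝ v w * ∫ t : ℝ, ψ (t • e)) + τ ^ 2 * C ∧
    Tendsto (fun ε => (ε ^ 2)⁻¹ * δ ε) (𝓝[>] 0) (𝓝 d) ∧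
    ∀ᶠ ε in 𝓝[>] (0 : ℝ), ∀ hε : 0 < ε, ∀ φ : Form 2, (∀ y, ‖φ y‖ ≤ 1) →
      (bumpDeformation hψ x w τ hε).push S hfin φ ≤ (mass S).toReal + μ * δ ε

/-- A smooth surface whose boundary near `x` is a smooth curve has a half-plane with the tangent
line of the curve as its edge as its tangent cone, and its unit direction is the conormal. -/
theorem SmoothChart.Represents.exists_conormal {c c' : SmoothChart} {S : Current 2} {M : Current 1}
    {m m' : ℤ} {u₀ : EuclideanSpace ℝ (Fin 2)} {u₁ : EuclideanSpace ℝ (Fin 1)}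
    (hS : c.Represents m S) (hm : m ≠ 0) (hM : c'.Represents m' M) (hm' : m' ≠ 0)
    (hu₀ : u₀ ∈ c.dom 2) (hu₁ : u₁ ∈ c'.dom 1) (hx : c.param 2 u₀ = c'.param 1 u₁)
    (hint : u₁ 0 ≠ 0) {s : Set E3} (hs : s ∈ 𝓝 (c'.param 1 u₁))
    (hbd : ∀ φ : Form 1, tsupport φ ⊆ s → boundary S φ = M φ) (hfin : mass S ≠ ⊤)
    {e : E3} (he : ‖e‖ = 1) {r : ℝ} (hr : r ≠ 0) (hc' : c'.tangent 1 u₁ 0 = r • e) :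
    ∃ v : E3, ‖v‖ = 1 ∧ inner ℝ e v = (0 : ℝ) ∧
      tangentConeOf (supp S) (c.param 2 u₀) = halfPlane (c.param 2 u₀) e v ∧
      HasConormal S hfin (c.param 2 u₀) |(m' : ℝ)| e v := by
  obtain ⟨hu, hmm, κ, hκ, hab⟩ := hS.boundary_alignment hM hm' hu₀ hu₁ hx hint hs hbd
  have hξ := cross_tangent_ne_zero hu₀
  have hb : c.tangent 2 u₀ 1 = (r / κ) • e := by
    rw [div_eq_inv_mul, mul_smul, ← hc', hab, smul_smul, inv_mul_cancel₀ hκ, one_smul]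
  have hrκ : r / κ ≠ 0 := div_ne_zero hr hκ
  obtain ⟨v, α, β, hv, hev, hβ, ha⟩ := exists_page he hb hξ
  refine ⟨v, hv, hev, ?_, fun ψ R hψ w => ?_⟩
  · rw [hS.tangentConeOf_supp hm (by simp) (by simp) hu₀ fun u hu =>
      ⟨crossForm (cross (c.tangent 2 u 0) (c.tangent 2 u 1)), by
        rw [crossForm_apply]
        exact inner_self_ne_zero.2 (cross_tangent_ne_zero hu)⟩, halfPlane_eq hrκ hb hβ ha]
    ext y
    constructor
    · rintro ⟨p, hp, rfl⟩
      refine ⟨p 0, p 1, ?_, by rw [tangentMap_two]⟩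
      simpa [coordIncl_two_zero] using hp (by rwa [coordIncl_two_zero])
    · rintro ⟨s, t, hs, rfl⟩
      refine ⟨planePoint (s, t), fun _ => ?_, ?_⟩
      · rwa [coordIncl_two_zero, planePoint_apply_zero]
      · rw [tangentMap_two, planePoint_eq]
        simp
  · obtain ⟨χ, hχ, hχ0, hχ1, hχR⟩ := exists_isBump (r := |R| + 1) (by positivity)
    have hχR' : ∀ z, ‖z‖ ≤ R → χ z = 1 := fun z hz =>
      hχR z (hz.trans ((le_abs_self R).trans (by simp)))
    obtain ⟨C, hC⟩ := exists_movedArea_bound hu₀ hu hψ hχ hχ0 hχR' w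
    refine ⟨C, fun τ => ?_⟩
    set a := c.tangent 2 u₀ 0
    set b := c.tangent 2 u₀ 1
    -- With the unit normal of the tangent plane at the point, the flux through `n` becomes the area
    -- in the limit, so nothing is lost to leading order.
    set n := ‖cross a b‖⁻¹ • cross a b with hn
    have hn1 : ‖n‖ = 1 := by
      rw [hn, norm_smul, norm_inv, norm_norm, inv_mul_cancel₀ (norm_ne_zero_iff.2 hξ)]
    have hnξ : crossForm n (c.tangent 2 u₀) = ‖cross a b‖ := by
      rw [crossForm_apply, hn, real_inner_smul_left, real_inner_self_eq_norm_sq, pow_two,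
        inv_mul_cancel_left₀ (norm_ne_zero_iff.2 hξ)]
    have hχn : ∀ z p, |R| + 1 + 1 + 1 ≤ ‖z‖ → χ z * crossForm n p = 0 := fun z p hz => by
      rw [hχ.eq_zero z (by linarith), zero_mul]
    have hχm : ∀ z p, |R| + 1 + 1 + 1 ≤ ‖z‖ → χ z * movedArea ψ w τ (z, p) = 0 := fun z p hz => by
      rw [hχ.eq_zero z (by linarith), zero_mul]
    have hl1 := c.tendsto_blowup (by simp) hu₀ (f := fun q => χ q.1 * movedArea ψ w τ q)
      ((hχ.contDiff.continuous.comp continuous_fst).mul (continuous_movedArea hψ w τ)) hχm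
    have hl2 := c.tendsto_blowup (by simp) hu₀ (f := fun q => χ q.1 * crossForm n q.2)
      ((hχ.contDiff.continuous.comp continuous_fst).mul
        ((crossForm n).cont.comp continuous_snd)) hχn
    simp only [hnξ] at hl2
    refine ⟨_, _, (hC τ).trans_eq ?_, (hl1.sub hl2).congr fun ε => (mul_sub _ _ _).symm, ?_⟩
    · rw [conormal_coefficient he hv hev hrκ hb hβ ha]
    -- The weight is expressed by the multiplicity of the curve, so it is the same for all sheets.
    · rw [← hmm]
      exact hS.push_apply_le hfin hu₀ hψ hχ hχ0 hχ1 hχR' w τ hn1.le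

/-- The radius is enlarged by the maximal displacement `ε * |τ| * ‖w‖`, so moved points stay in the
ball that bounds the support of the replacement. -/
theorem mapsTo_bumpDeformation {ψ : E3 → ℝ} {R : ℝ} (hψ : IsBump ψ R) (h0 : ∀ z, 0 ≤ ψ z)
    (h1 : ∀ z, ψ z ≤ 1) (x w : E3) (τ : ℝ) {ε : ℝ} (hε : 0 < ε) :
    Set.MapsTo (bumpDeformation hψ x w τ hε).toFun (Metric.closedBall x (ε * (R + |τ| * ‖w‖)))
      (Metric.closedBall x (ε * (R + |τ| * ‖w‖))) := by
  intro y hy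
  rw [bumpDeformation_apply]
  rcases le_or_gt ‖ε⁻¹ • (y - x)‖ R with h | h
  · rw [norm_smul, norm_inv, Real.norm_of_nonneg hε.le, inv_mul_le_iff₀ hε] at h
    rw [mem_closedBall_iff_norm]
    have h2 : y + (ε * τ * ψ (ε⁻¹ • (y - x))) • w - x
        = (y - x) + (ε * τ * ψ (ε⁻¹ • (y - x))) • w := by abel
    rw [h2, mul_add]
    refine (norm_add_le _ _).trans (add_le_add h ?_)
    rw [norm_smul, Real.norm_eq_abs, abs_mul, abs_mul, abs_of_pos hε, abs_of_nonneg (h0 _),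
      ← mul_assoc ε]
    refine mul_le_mul_of_nonneg_right ?_ (norm_nonneg _)
    exact mul_le_of_le_one_right (by positivity) (h1 _)
  · rwa [hψ.eq_zero _ h, mul_zero, zero_smul, add_zero]

/-- If the conormals of the spanning surfaces do not cancel, a local deformation lowers the cost. -/
theorem exists_lower_cost {N : ℕ} {lam : ℝ≥0} (hlam : 0 < lam) {T : Fin N → Current 1}
    {M : Current 1} (hM : IsIntegral M) {S : Fin N → Current 2}
    (hS : ∀ i, IsSpanningMinimalSurface lam M (T i) (S i)) {x : E3}
    (hx : x ∉ supp (boundary M)) (hxT : ∀ i, x ∉ supp (T i)) (hfin : ∀ i, mass (S i) ≠ ⊤)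
    {μ : ℝ} (hμ : 0 < μ) {e : E3} (he : e ≠ 0) {v : Fin N → E3}
    (hv : ∀ i, HasConormal (S i) (hfin i) x μ e (v i)) (hne : ∑ i, v i ≠ 0)
    {U : Set E3} (hU : U ∈ 𝓝 x) :
    ∃ M' : Current 1, IsIntegral M' ∧ boundary M' = boundary M ∧ supp (M' - M) ⊆ U ∧
      medianCost lam T M' < medianCost lam T M := by
  obtain ⟨ψ, hψ, h0, h1, h2⟩ := exists_isBump zero_lt_one
  set R : ℝ := 1 + 1
  -- Moving in the direction of the sum of conormals makes the total first variation `-τ * ‖w‖² *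
  -- K`.
  set w := ∑ i, v i with hw
  set K := ∫ t : ℝ, ψ (t • e) with hK
  have hKpos : 0 < K := SmoothChart.integral_line_pos hψ h0 (h2 0 (by simp)) he
  choose C hC using fun i => hv i ψ R hψ w
  have hwpos : 0 < ‖w‖ ^ 2 := by positivity
  -- Chosen so that the quadratic error stays strictly below the linear gain. It is fixed before
  -- `ε`, as the limits in `ε` are taken for given `τ`.
  set τ : ℝ := ‖w‖ ^ 2 * K / (|∑ i, C i| + 1) with hτ
  have hτpos : 0 < τ := by positivity
  choose δ d hd hlim hmass using fun i => hC i τ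
  have hsum : ∑ i, d i < 0 := by
    refine (Finset.sum_le_sum fun i _ => hd i).trans_lt ?_
    rw [Finset.sum_add_distrib, ← Finset.mul_sum, ← Finset.mul_sum, ← Finset.sum_mul, ← sum_inner,
      ← hw, real_inner_self_eq_norm_sq]
    have h3 : τ * (|∑ i, C i| + 1) = ‖w‖ ^ 2 * K := div_mul_cancel₀ _ (by positivity)
    have h4 : τ * ∑ i, C i < ‖w‖ ^ 2 * K := by
      rw [← h3]
      exact mul_lt_mul_of_pos_left ((le_abs_self _).trans_lt (lt_add_one _)) hτpos
    nlinarith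
  have hlim' : Tendsto (fun ε : ℝ => (ε ^ 2)⁻¹ * ∑ i, δ i ε) (𝓝[>] 0) (𝓝 (∑ i, d i)) := by
    simp only [Finset.mul_sum]
    exact tendsto_finsetSum _ fun i _ => hlim i
  obtain ⟨s, hs, hso, hxs⟩ := (Distribution.notMem_dsupport_iff _).1 hx
  choose t ht hto hxt using fun i => (Distribution.notMem_dsupport_iff _).1 (hxT i)
  obtain ⟨ε, ⟨⟨⟨⟨⟨hε1, hε2⟩, hε3⟩, hε4⟩, hε5⟩, hε⟩⟩ :=
    (((((hlim'.eventually_lt_const hsum).and (eventually_all.2 hmass)).and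
      (eventually_closedBall_subset hU (R + |τ| * ‖w‖))).and
      (eventually_closedBall_subset (hso.mem_nhds hxs) R)).and
      (eventually_all.2 fun i =>
        eventually_closedBall_subset ((hto i).mem_nhds (hxt i)) R)).and
      self_mem_nhdsWithin |>.exists
  set h := bumpDeformation hψ x w τ hε
  have hsupp : tsupport (fun y => h.toFun y - y) ⊆ Metric.closedBall x (ε * R) :=
    tsupport_bumpDeformation_subset hψ x w τ hε
  have hbM : boundary (h.push M hM.1.mass_ne_top) = boundary M := by
    ext φ
    rw [h.boundary_push_apply, h.apply_pullback_eq hs (hsupp.trans hε4)]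
  refine ⟨h.push M hM.1.mass_ne_top, ⟨h.isRectifiable_push hM.1, ?_⟩, hbM, ?_, ?_⟩
  · rw [hbM]
    exact hM.2
  · refine (h.supp_push_sub_subset M _ Metric.isClosed_closedBall (hsupp.trans ?_)
      (mapsTo_bumpDeformation hψ h0 h1 x w τ hε)).trans hε3
    exact Metric.closedBall_subset_closedBall (by
      have : 0 ≤ |τ| * ‖w‖ := by positivity
      nlinarith)
  · have hbS : ∀ i, boundary (h.push (S i) (hfin i)) = h.push M hM.1.mass_ne_top - T i := by
      intro i
      ext φ
      rw [h.boundary_push_apply, (hS i).boundary_eq]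
      change M (h.pullback 1 φ) - T i (h.pullback 1 φ) = M (h.pullback 1 φ) - T i φ
      rw [h.apply_pullback_eq (ht i) (hsupp.trans (hε5 i))]
    set ρ : Fin N → ℝ := fun i => (mass (S i)).toReal + μ * δ i ε with hρ
    -- The bound evaluated at `φ = 0`. Nonnegativity lets `ENNReal.ofReal` pass through the sum.
    have hρ0 : ∀ i, 0 ≤ ρ i := fun i => by
      simpa using hε2 i hε 0 (fun y => by simp)
    have hlt : ∑ i, ρ i < ∑ i, (mass (S i)).toReal := by
      rw [hρ, Finset.sum_add_distrib, ← Finset.mul_sum]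
      have h3 : ∑ i, δ i ε < 0 := by
        by_contra hc
        exact absurd hε1 (not_lt.2 (mul_nonneg (by positivity) (not_lt.1 hc)))
      have := mul_neg_of_pos_of_neg hμ h3
      linarith
    -- The pushed surfaces need not be minimal: as competitors they bound the new flat norms from
    -- above, while the old flat norms are attained by `S i`.
    calc medianCost lam T (h.push M hM.1.mass_ne_top)
        ≤ ∑ i, (lam : ℝ≥0∞) * ENNReal.ofReal (ρ i) := by
          refine Finset.sum_le_sum fun i _ => (flatNorm_le_mul_mass lam (hbS i)).trans ?_
          gcongr
          exact mass_le_ofReal (hε2 i hε)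
      _ = lam * ENNReal.ofReal (∑ i, ρ i) := by
          rw [← Finset.mul_sum, ENNReal.ofReal_sum_of_nonneg fun i _ => hρ0 i]
      _ < lam * ENNReal.ofReal (∑ i, (mass (S i)).toReal) := by
          refine (ENNReal.mul_lt_mul_iff_right (by simpa using hlam.ne') (by simp)).2 ?_
          exact (ENNReal.ofReal_lt_ofReal_iff
            ((Finset.sum_nonneg fun i _ => hρ0 i).trans_lt hlt)).2 hlt
      _ = medianCost lam T M := by
          rw [ENNReal.ofReal_sum_of_nonneg fun i _ => ENNReal.toReal_nonneg, Finset.mul_sum]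
          refine Finset.sum_congr rfl fun i _ => ?_
          rw [ENNReal.ofReal_toReal (hfin i), (hS i).flatNorm_eq]

/-- The tangent cones are always half-planes with the tangent line of `M` as common edge. Hence the
balance of the conormals is the only condition that can fail. -/
theorem book_or_lower_cost {N : ℕ} {lam : ℝ≥0} (hlam : 0 < lam) {T : Fin N → Current 1}
    (hT : ∀ i, IsIntegral (T i)) {M : Current 1} (hM : IsIntegral M) {S : Fin N → Current 2}
    (hS : ∀ i, IsSpanningMinimalSurface lam M (T i) (S i)) {x : E3}
    (hx : x ∉ supp (boundary M)) (hxT : ∀ i, x ∉ supp (T i)) (hMs : IsSmoothAt M x)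
    (hSs : ∀ i, IsSmoothAt (S i) x) (hbook : ¬ HasBookTangentConesAt M S x)
    {U : Set E3} (hU : U ∈ 𝓝 x) :
    ∃ M' : Current 1, IsIntegral M' ∧ boundary M' = boundary M ∧ supp (M' - M) ⊆ U ∧
      medianCost lam T M' < medianCost lam T M := by
  obtain ⟨c', u₁, m', hu₁, rfl, hm', hMr⟩ := hMs.exists_chart
  have hint := hMr.ne_zero_of_notMem_supp_boundary hm' hu₁ hx
  have hfin : ∀ i, mass (S i) ≠ ⊤ := fun i => (hS i).mass_ne_top hlam hM.1 (hT i).1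
  have ht0 := SmoothChart.tangent_one_ne_zero hu₁
  set p := c'.tangent 1 u₁ 0 with hp
  have hpn : ‖p‖ ≠ 0 := norm_ne_zero_iff.2 ht0
  set e := ‖p‖⁻¹ • p with he
  have he1 : ‖e‖ = 1 := by rw [he, norm_smul, norm_inv, norm_norm, inv_mul_cancel₀ hpn]
  have hpe : p = ‖p‖ • e := by rw [he, smul_smul, mul_inv_cancel₀ hpn, one_smul]
  have hline : tangentConeOf (supp M) (c'.param 1 u₁) = line (c'.param 1 u₁) e := by
    rw [hMr.tangentConeOf_supp hm' (by simp) (by simp) hu₁ fun u hu =>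
      ⟨innerForm (c'.tangent 1 u 0), by
        rw [innerForm_apply]
        exact inner_self_ne_zero.2 (SmoothChart.tangent_one_ne_zero hu)⟩]
    ext y
    constructor
    · rintro ⟨q, -, rfl⟩
      have hq : q = linePoint (q 0) := by
        ext j
        fin_cases j
        simp [linePoint]
      refine ⟨q 0 * ‖p‖, ?_⟩
      rw [hq, SmoothChart.tangentMap_linePoint, ← hp, mul_smul, ← hpe, ← hq]
    · rintro ⟨t, rfl⟩
      refine ⟨linePoint (t / ‖p‖), fun h => ?_, ?_⟩
      · rw [SmoothChart.coordIncl_one_zero] at h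
        exact absurd h hint
      · rw [SmoothChart.tangentMap_linePoint, ← hp, he, smul_smul, div_eq_mul_inv]
  have hcon : ∀ i, ∃ v : E3, ‖v‖ = 1 ∧ inner ℝ e v = (0 : ℝ) ∧
      tangentConeOf (supp (S i)) (c'.param 1 u₁) = halfPlane (c'.param 1 u₁) e v ∧
      HasConormal (S i) (hfin i) (c'.param 1 u₁) |(m' : ℝ)| e v := by
    intro i
    obtain ⟨c, u₀, m, hu₀, hxu, hm, hSr⟩ := (hSs i).exists_chart
    obtain ⟨s, hs, hso, hxs⟩ := (Distribution.notMem_dsupport_iff _).1 (hxT i)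
    rw [← hxu]
    refine hSr.exists_conormal hm hMr hm' hu₀ hu₁ hxu hint (hso.mem_nhds hxs) (fun φ hφ => ?_)
      (hfin i) he1 hpn hpe
    -- Near the point `T i` vanishes, so there the boundary of `S i` is `M` alone.
    rw [(hS i).boundary_eq]
    change M φ - T i φ = M φ
    have : T i φ = 0 := hs φ hφ
    rw [this, sub_zero]
  choose v hv1 hv2 hv3 hv4 using hcon
  by_cases hsum : ∑ i, v i = 0
  · refine absurd ⟨e, he1, hline, fun r h _ _ => ⟨v, fun i => ⟨hv1 i, hv2 i⟩, hsum, fun i => ?_⟩⟩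
      hbook
    simp only [hv3]
  · refine exists_lower_cost hlam hM hS hx hxT hfin (abs_pos.2 (by exact_mod_cast hm')) ?_ hv4
      hsum hU
    exact norm_ne_zero_iff.1 (by rw [he1]; exact one_ne_zero)

end MedianCurrents

end

theorem mainTheorem7 (N : ℕ) (lam : ℝ≥0) (hlam : 0 < lam)
    (T : Fin N → MedianCurrents.Current 1)
    (hT : ∀ i, MedianCurrents.IsIntegral (T i))
    (hshared : ∀ i j, MedianCurrents.boundary (T i) = MedianCurrents.boundary (T j))
    (M : MedianCurrents.Current 1) (hM : MedianCurrents.IsIntegral M)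
    (S : Fin N → MedianCurrents.Current 2)
    (hS : ∀ i, MedianCurrents.IsSpanningMinimalSurface lam M (T i) (S i))
    (x : MedianCurrents.E3)
    (hx : x ∈ MedianCurrents.supp M \ MedianCurrents.supp (MedianCurrents.boundary M))
    (hxT : ∀ i, x ∉ MedianCurrents.supp (T i))
    (hMsmooth : MedianCurrents.IsSmoothAt M x)
    (hSsmooth : ∀ i, MedianCurrents.IsSmoothAt (S i) x) :
    (MedianCurrents.IsMedian lam T M → MedianCurrents.HasBookTangentConesAt M S x) ∧
    (¬ MedianCurrents.HasBookTangentConesAt M S x →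
      ∀ U ∈ 𝓝 x, ∃ M' : MedianCurrents.Current 1,
        MedianCurrents.IsIntegral M' ∧
        MedianCurrents.boundary M' = MedianCurrents.boundary M ∧
        MedianCurrents.supp (M' - M) ⊆ U ∧
        MedianCurrents.medianCost lam T M' < MedianCurrents.medianCost lam T M) := by
  have key := fun hbook U (hU : U ∈ 𝓝 x) =>
    MedianCurrents.book_or_lower_cost hlam hT hM hS hx.2 hxT hMsmooth hSsmooth hbook hU
  refine ⟨fun hmed => ?_, key⟩
  by_contra hbook
  -- Locality plays no role for medians: any cheaper competitor with the same boundary contradicts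
  -- minimality.
  obtain ⟨M', hM', hb, -, hlt⟩ := key hbook Set.univ Filter.univ_mem
  exact absurd (hmed.minimal M' hM' fun i => hb.trans (hmed.boundary_eq i)) (not_le.2 hlt)
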